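/- **Notation.** For a finite set $S\subset\mathbb R^d$ let $\mu(S)$ be its mean, for a unit vector $v$ let $\sigma_v(S)^2=\frac1{|S|}\sum_{x\in S}(v\cdot(x-\mu(S)))^2$, and let $\sigma(S)=\max_{|v|=1}\sigma_v(S)$. For a probability density $F$ on $\mathbb R^d$ ($d\ge 1$) let $\hat\mu(F)$ be its mean, $\hat\sigma_v(F)$ the standard deviation of $v\cdot X$ for $X\sim F$, and $\hat\sigma(F)=\max_{|v|=1}\hat\sigma_v(F)$. The density $F$ satisfies *anti-concentration* if for every unit vector $u$ the marginal density $F_u$ of $u\cdot X$ satisfies $F_u\le 4/\hat\sigma_u(F)$ almost everywhere. The sub-Gaussian norm of $X\sim F$ is $\|F\|_{sg}=\sup_{|v|=1}\sup_{p\ge 1}\,p^{-1/2}\,(\mathbb E|v\cdot(X-\hat\mu(F))|^p)^{1/p}$; $F$ is *sub-Gaussian* if this is finite, and then its *shape parameter* is $\kappa(F)=\|F\|_{sg}/\lambda_{\min}^{1/2}(\Sigma)$, where $\Sigma$ is the covariance matrix of $F$. For $K>0$ and $w_0\in(0,1]$ put $\gamma=K/w_0^{11}$. Let $S$ be a set of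 $n$ points partitioned into clusters $C_1,\dots,C_k$. The clusters are *well-separated* if they are nonempty and $|\mu(C_\ell)-\mu(C_{\ell'})|\ge\gamma\max_r\sigma(C_r)$ for all $\ell\ne\ell'$. They satisfy *NTSC* (no tight sub-cluster) if for every $\ell$, every $T\subseteq C_\ell$ with $|T|\ge\sqrt n\,\ln n/100$ and every one-dimensional subspace $L$, with $\pi_L$ the orthogonal projection onto $L$, $$\sigma(\pi_L(T))\ \ge\ \frac{|T|}{125\,|C_\ell|}\,\sigma(\pi_L(C_\ell)).$$ **Theorem.** There are absolute constants $c>0$ and $K_0>0$ and a sequence $\delta(n)\to 0$ such that the following hold for all $K\ge K_0$. 1. Let $w_0>0$ and let $F=\sum_{\ell=1}^k w_\ell F_\ell$ be a mixture of sub-Gaussian probability densities on $\mathbb R^d$ satisfying anti-concentration, with $\sum_\ell w_\ell=1$, $w_\ell\ge w_0$, and $|\hat\mu(F_\ell)-\hat\mu(F_{\ell'})|\ge 6\gamma\max_r\hat\sigma(F_r)$ for all $\ell\neq\ell'$. Let $\kappa_0=\max_\ell\kappa(F_\ell)$. Draw $n$ iid samples from $F$, where $$n\ge \frac{c\,\kappa_0^4d^2}{w_0}\qquad\text{and}\qquad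 n\ge\frac{100}{w_0^5},$$ and let $C_\ell$ be the set of samples drawn from $F_\ell$. Then with probability at least $1-\delta(n)$ the clusters $C_1,\dots,C_k$ are well-separated and satisfy NTSC. 2. Let $w_0\in(0,1]$ and let $F$ be a sub-Gaussian probability density on $\mathbb R^d$. Let the sample complexity $\mathrm{sc}(F)$ be the least integer $s$ such that for all $m\ge s$, a set $S$ of $m$ iid samples from $F$ satisfies, with probability at least $1-\delta(m)$, both $|\mu(S)-\hat\mu(F)|\le\gamma\hat\sigma(F)$ and $\sigma_v(S)\le 2\hat\sigma_v(F)$ for all unit vectors $v$. Then $\mathrm{sc}(F)$ exists and $\mathrm{sc}(F)\le 100\,\kappa(F)^4d^2$. -/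

import Mathlib

open MeasureTheory ProbabilityTheory Filter Topology
open scoped ENNReal

noncomputable section

namespace SubGaussianMixture

/-- Euclidean space `ℝ^d`. -/
abbrev E (d : ℕ) : Type := EuclideanSpace ℝ (Fin d)

/-! ### Finite point sets

A finite set of sample points is given by a family of points `x : ι → ℝ^d` together with a finite
set `S` of indices (a sample from a density consists of distinct points almost surely). -/

/-- The mean `μ(S)`. -/
def mean {d : ℕ} {ι : Type*} (x : ι → E d) (S : Finset ι) : E d :=
  (S.card : ℝ)⁻¹ • ∑ i ∈ S, x i

/-- The standard deviation `σ_v(S)` in direction `v`. -/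
def dirStd {d : ℕ} {ι : Type*} (x : ι → E d) (S : Finset ι) (v : E d) : ℝ :=
  Real.sqrt ((S.card : ℝ)⁻¹ * ∑ i ∈ S, (inner ℝ v (x i - mean x S)) ^ 2)

/-- The maximum directional standard deviation `σ(S)`. -/
def std {d : ℕ} {ι : Type*} (x : ι → E d) (S : Finset ι) : ℝ :=
  ⨆ v : Metric.sphere (0 : E d) 1, dirStd x S v

/-- Well-separatedness with factor `γ`: the clusters are nonempty (so that they have means), and
`|μ(C_ℓ) - μ(C_ℓ')| ≥ γ max_r σ(C_r)` for all distinct `ℓ`, `ℓ'`. -/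
def WellSeparated {n k d : ℕ} (γ : ℝ) (x : Fin n → E d) (C : Fin k → Finset (Fin n)) : Prop :=
  (∀ ℓ, (C ℓ).Nonempty) ∧
  ∀ ℓ ℓ', ℓ ≠ ℓ' → γ * (⨆ r, std x (C r)) ≤ ‖mean x (C ℓ) - mean x (C ℓ')‖

/-- The no-tight-sub-cluster condition: for every cluster `C_ℓ`, every `T ⊆ C_ℓ` with
`|T| ≥ √n log n / 100` and every line `L` through the origin,
`σ(π_L(T)) ≥ |T| / (125 |C_ℓ|) * σ(π_L(C_ℓ))`, written with squares. -/
def NTSC {n k d : ℕ} (x : Fin n → E d) (C : Fin k → Finset (Fin n)) : Prop :=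
  ∀ ℓ, ∀ T ⊆ C ℓ, Real.sqrt n * Real.log n / 100 ≤ (T.card : ℝ) →
    ∀ L : Submodule ℝ (E d), Module.finrank ℝ L = 1 →
      ((T.card : ℝ) / (125 * (C ℓ).card)) ^ 2 * std (fun i => L.starProjection (x i)) (C ℓ) ^ 2
        ≤ std (fun i => L.starProjection (x i)) T ^ 2

/-! ### Probability densities -/

/-- `f` is a probability density function on `ℝ^d`. -/
structure IsPDF {d : ℕ} (f : E d → ℝ) : Prop where
  measurable : Measurable f
  nonneg : ∀ x, 0 ≤ f x
  total : ∫⁻ x, ENNReal.ofReal (f x) = 1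

/-- The distribution with density `f`. -/
def law {d : ℕ} (f : E d → ℝ) : Measure (E d) :=
  volume.withDensity fun x => ENNReal.ofReal (f x)

/-- The mean of a density. -/
def pdfMean {d : ℕ} (f : E d → ℝ) : E d := ∫ x, x ∂law f

/-- The standard deviation of the one-dimensional marginal along `v`. -/
def pdfDirStd {d : ℕ} (f : E d → ℝ) (v : E d) : ℝ :=
  Real.sqrt (variance (fun x => (inner ℝ v x : ℝ)) (law f))

/-- The maximum directional standard deviation of a density. -/
def pdfStd {d : ℕ} (f : E d → ℝ) : ℝ :=
  ⨆ v : Metric.sphere (0 : E d) 1, pdfDirStd f v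

/-- Anti-concentration: for every unit vector `u`, the marginal density along `u` is bounded by
`4 / σ_u`. A density is determined up to null sets, so the bound is required almost everywhere. -/
def AntiConcentration {d : ℕ} (f : E d → ℝ) : Prop :=
  ∀ u : E d, ‖u‖ = 1 →
    ∀ᵐ ζ : ℝ, pdf (fun x : E d => (inner ℝ u x : ℝ)) (law f) volume ζ
      ≤ ENNReal.ofReal (4 / pdfDirStd f u)

/-- The sub-Gaussian norm `sup_{p ≥ 1} (E|X|^p)^{1/p} / √p` of a real random variable. -/
def sgNorm {Ω : Type*} [MeasurableSpace Ω] (X : Ω → ℝ) (P : Measure Ω) : ℝ≥0∞ :=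
  ⨆ (p : ℝ) (_ : 1 ≤ p), eLpNorm X (ENNReal.ofReal p) P / ENNReal.ofReal (Real.sqrt p)

/-- The sub-Gaussian norm of a (centred) random vector with density `f`. -/
def pdfSgNorm {d : ℕ} (f : E d → ℝ) : ℝ≥0∞ :=
  ⨆ (v : E d) (_ : ‖v‖ = 1), sgNorm (fun x => (inner ℝ v (x - pdfMean f) : ℝ)) (law f)

/-- `f` is a sub-Gaussian density. -/
def IsSubGaussian {d : ℕ} (f : E d → ℝ) : Prop := pdfSgNorm f < ⊤

/-- The variance-covariance matrix of a density. -/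
def covMatrix {d : ℕ} (f : E d → ℝ) : Matrix (Fin d) (Fin d) ℝ :=
  Matrix.of fun i j => covariance (fun x : E d => x i) (fun x : E d => x j) (law f)

/-- The shape parameter `κ`: the sub-Gaussian norm divided by the square root of the smallest
eigenvalue of the covariance matrix. -/
def shape {d : ℕ} (f : E d → ℝ) : ℝ :=
  (pdfSgNorm f).toReal / Real.sqrt (sInf (spectrum ℝ (covMatrix f)))

/-! ### Sampling -/

/-- The event that `m` sample points `x` from `f` meet the two requirements in the definition of
sample complexity. -/
def GoodSample {d m : ℕ} (γ : ℝ) (f : E d → ℝ) (x : Fin m → E d) : Prop :=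
  ‖mean x Finset.univ - pdfMean f‖ ≤ γ * pdfStd f ∧
  ∀ v : E d, ‖v‖ = 1 → dirStd x Finset.univ v ≤ 2 * pdfDirStd f v

/-- The sample complexity of `f`, where `with high probability` for `m` samples means with
probability at least `1 - δ m`: the least `s` such that for all `m ≥ s`, the requirements hold with
high probability for `m` iid samples (and `⊤` if there is no such `s`). -/
def sampleComplexity {d : ℕ} (δ : ℕ → ℝ) (γ : ℝ) (f : E d → ℝ) : ℕ∞ :=
  ⨅ (s : ℕ) (_ : ∀ m, s ≤ m →
    Measure.pi (fun _ : Fin m => law f) {x | ¬ GoodSample γ f x} ≤ ENNReal.ofReal (δ m)), (s : ℕ∞)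

/-- The law of one labelled draw from the mixture `∑ w_ℓ F_ℓ`: the label is `ℓ` with probability
`w_ℓ`, and given this the point is drawn from `F_ℓ`. -/
def labelledMixture {k d : ℕ} (w : Fin k → ℝ) (f : Fin k → E d → ℝ) : Measure (Fin k × E d) :=
  ∑ ℓ, ENNReal.ofReal (w ℓ) • (Measure.dirac ℓ).prod (law (f ℓ))

/-- The law of `n` iid labelled draws from the mixture. -/
def sampleLaw {k d : ℕ} (n : ℕ) (w : Fin k → ℝ) (f : Fin k → E d → ℝ) :
    Measure (Fin n → Fin k × E d) :=
  Measure.pi fun _ => labelledMixture w f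

/-- The points of a labelled sample. -/
def points {n k d : ℕ} (ω : Fin n → Fin k × E d) : Fin n → E d := fun i => (ω i).2

/-- The cluster `C_ℓ`: (the indices of) the samples drawn from component `ℓ`. -/
def cluster {n k d : ℕ} (ω : Fin n → Fin k × E d) (ℓ : Fin k) : Finset (Fin n) :=
  Finset.univ.filter fun i => (ω i).1 = ℓ

/-- The separation factor `γ = K / w₀^11`. -/
def sepFactor (K w₀ : ℝ) : ℝ := K / w₀ ^ 11

end SubGaussianMixture

end

open SubGaussianMixture

namespace SubGaussianMixture

/-! Everything is done in standardised coordinates, one component at a time. `whiten` is Σ^(-1/2)(X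
- μ) in an eigenbasis of Σ. The whitened law is isotropic, with marginal moments of order 2j at most
(2j)^j κ^(2j) for j = 2, 3, 4 (`isWhite_map_whiten`). Anti-concentration becomes a bound on the
measure of slabs (`slabBound_map_whiten`).

Moments. Let m = n w be the expected cluster size. It suffices that the size is close to m, that the
sum of the whitened points has norm below m, and that the sum of the matrices Z = y yᵀ - 1 has
Frobenius norm below 2m. The Frobenius norm dominates the operator norm, so the last event controls
all directions at once. Markov's inequality for the squared Frobenius norm gives only a constant
failure probability when m is of order κ⁴d², whereas δ must tend to 0. So the squared norm is shown
to concentrate about its mean (`integral_norm_sum_sq_sub_sq_le`). Its variance involves E⟨Z,Z'⟩²,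
bounded by order κ⁶d², and E‖Z‖⁴, bounded by order κ⁸d⁴. The exponent 6 comes from Cauchy-Schwarz
between second and sixth moments; the direct bound κ⁸d² would not give decay for bounded d.
Chebyshev's inequality then fails with probability O(m^(-1/2)) (`moment_arith`).

Tight sub-clusters. If T has deviation at most s in some direction, three quarters of T lies in a
slab of half-width 2s, hence in a slightly wider slab from a finite grid (`exists_slabGrid`). For
the critical s the expected number of points in that slab is at most 0.332|T|, so a Chernoff bound
(`real_count_le`) makes this event have probability at most exp(-0.18|T|). Since |T| ≥ √n log n /
100 and √n ≥ 8900 d, this beats the n^O(d) grid slabs (`grid_union_bound`).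

Finally the failure probabilities are summed over at most 1/w₀ components (`union_arith`). -/

/-! ### Second moments and exponential tails of sums of iid variables. -/

lemma integral_sum_sq_pi {Ω : Type*} [MeasurableSpace Ω] (P : Measure Ω) [IsProbabilityMeasure P]
    {X : Ω → ℝ} (hX : MemLp X 2 P) (h0 : ∫ ω, X ω ∂P = 0) (n : ℕ) :
    ∫ ω, (∑ i, X (ω i)) ^ 2 ∂(Measure.pi fun _ : Fin n => P) = n * ∫ ω, X ω ^ 2 ∂P := by
  have h := variance_sum_pi (ι := Fin n) (μ := fun _ => P) (X := fun _ => X) (fun _ => hX)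
  have hi : ∀ i : Fin n, MemLp (fun ω : Fin n → Ω => X (ω i)) 2 (Measure.pi fun _ => P) := fun i =>
    hX.comp_measurePreserving (measurePreserving_eval (fun _ : Fin n => P) i)
  have hz : ∀ i : Fin n, ∫ ω : Fin n → Ω, X (ω i) ∂(Measure.pi fun _ => P) = 0 := fun i => by
    rw [integral_comp_eval (μ := fun _ : Fin n => P) (i := i) hX.aestronglyMeasurable]; exact h0
  have e : (∑ i, fun ω : Fin n → Ω => X (ω i)) = fun ω => ∑ i, X (ω i) := by
    ext ω; simp
  rw [e, variance_of_integral_eq_zero] at h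
  · rw [variance_of_integral_eq_zero hX.aemeasurable h0] at h
    simpa using h
  · exact (memLp_finsetSum _ fun i _ => hi i).aemeasurable
  · rw [integral_finsetSum _ fun i _ => (hi i).integrable (by norm_num)]
    simp [hz]

/-- Chernoff's bound with the base fixed at 2, since E 2^count = (1 + P(B))^n ≤ exp(nq). Optimising
the base is unnecessary because in the application the threshold exceeds twice the mean. -/
lemma real_count_le {Ω : Type*} [MeasurableSpace Ω] (P : Measure Ω) [IsProbabilityMeasure P]
    {B : Set Ω} (hB : MeasurableSet B) (n : ℕ) (q M : ℝ) (hq : P.real B ≤ q) :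
    (Measure.pi fun _ : Fin n => P).real
      {ω | M ≤ ∑ i, B.indicator (fun _ => (1 : ℝ)) (ω i)} ≤ Real.exp (n * q - Real.log 2 * M) := by
  set g : Ω → ℝ := fun ω => Real.exp (Real.log 2 * B.indicator (fun _ => (1 : ℝ)) ω) with hg
  have hg2 : g = fun ω => 1 + B.indicator (fun _ => (1 : ℝ)) ω := by
    ext ω
    by_cases h : ω ∈ B <;> simp [hg, h, Real.exp_log]; norm_num
  have hgi : ∫ ω, g ω ∂P = 1 + P.real B := by
    rw [hg2, integral_add (integrable_const _) ((integrable_const _).indicator hB)]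
    simp [integral_indicator hB]
  have hgint : Integrable g P := by
    rw [hg2]; exact (integrable_const _).add ((integrable_const _).indicator hB)
  have hprod : ∀ ω : Fin n → Ω, ∏ i, g (ω i) =
      Real.exp (Real.log 2 * ∑ i, B.indicator (fun _ => (1 : ℝ)) (ω i)) := fun ω => by
    rw [hg, ← Real.exp_sum, Finset.mul_sum]
  have h1 := mul_meas_ge_le_integral_of_nonneg (μ := Measure.pi fun _ : Fin n => P)
    (f := fun ω => ∏ i, g (ω i)) (Eventually.of_forall fun ω => by
      simp only [hprod]; exact (Real.exp_pos _).le)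
    (Integrable.fintype_prod (fun _ => hgint)) (Real.exp (Real.log 2 * M))
  rw [integral_fintype_prod_eq_prod (fun _ : Fin n => g)] at h1
  have hset : {ω : Fin n → Ω | M ≤ ∑ i, B.indicator (fun _ => (1 : ℝ)) (ω i)} =
      {ω | Real.exp (Real.log 2 * M) ≤ ∏ i, g (ω i)} := by
    ext ω
    simp only [Set.mem_ofPred_eq, hprod, Real.exp_le_exp]
    exact (mul_le_mul_iff_right₀ (Real.log_pos (by norm_num))).symm
  rw [hset, Real.exp_sub, le_div_iff₀ (Real.exp_pos _), mul_comm]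
  refine h1.trans ?_
  rw [hgi, Finset.prod_const, Finset.card_univ, Fintype.card_fin, Real.exp_nat_mul]
  have : 1 + P.real B ≤ Real.exp q := by linarith [Real.add_one_le_exp q]
  exact pow_le_pow_left₀ (by positivity) this n

lemma memLp_norm_sq {Ω H : Type*} [MeasurableSpace Ω] {P : Measure Ω} [NormedAddCommGroup H]
    {Z : Ω → H} (hZ : MemLp Z 4 P) : MemLp (fun ω => ‖Z ω‖ ^ 2) 2 P := by
  have hm : AEStronglyMeasurable (fun ω => ‖Z ω‖ ^ 2) P := hZ.aestronglyMeasurable.norm.pow 2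
  rw [memLp_two_iff_integrable_sq hm]
  have := hZ.integrable_norm_pow (p := 4) (by norm_num)
  refine this.congr (Eventually.of_forall fun ω => ?_)
  simp only []; ring

lemma integral_centered_norm_sq_le {Ω H : Type*} [MeasurableSpace Ω]
    [NormedAddCommGroup H] {P : Measure Ω} [IsProbabilityMeasure P] {Z : Ω → H}
    (hZ : MemLp Z 4 P) :
    ∫ x, (‖Z x‖ ^ 2 - ∫ y, ‖Z y‖ ^ 2 ∂P) ^ 2 ∂P ≤ ∫ x, ‖Z x‖ ^ 4 ∂P := by
  have h := memLp_norm_sq hZ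
  have h1 := variance_le_expectation_sq (μ := P) h.aestronglyMeasurable
  rw [variance_eq_integral h.aemeasurable] at h1
  refine h1.trans_eq (integral_congr_ae (Eventually.of_forall fun ω => ?_))
  simp only [Pi.pow_apply]; ring

lemma memLp_sum_pi {Ω : Type*} [MeasurableSpace Ω] {P : Measure Ω} [IsProbabilityMeasure P] {G : Type*} [NormedAddCommGroup G]
    {Z : Ω → G} {p : ℝ≥0∞} (hZ : MemLp Z p P) (n : ℕ) :
    MemLp (fun ω : Fin n → Ω => ∑ i, Z (ω i)) p (Measure.pi fun _ => P) :=
  memLp_finsetSum _ fun i _ =>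
    hZ.comp_measurePreserving (measurePreserving_eval (fun _ : Fin n => P) i)

/-! ### The squared norm of a sum of iid vectors. -/

section Hilbert

variable {Ω Ω' H : Type*} [MeasurableSpace Ω] [MeasurableSpace Ω'] [NormedAddCommGroup H]
  [InnerProductSpace ℝ H]

lemma memLp_inner_prod {P : Measure Ω} [IsProbabilityMeasure P] {ν : Measure Ω'}
    [IsProbabilityMeasure ν] {Z : Ω → H} {S : Ω' → H} (hZ : MemLp Z 4 P) (hS : MemLp S 4 ν) :
    MemLp (fun p : Ω × Ω' => (inner ℝ (S p.2) (Z p.1) : ℝ)) 2 (P.prod ν) := by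
  have hm : AEStronglyMeasurable (fun p : Ω × Ω' => (inner ℝ (S p.2) (Z p.1) : ℝ)) (P.prod ν) :=
    (hS.aestronglyMeasurable.comp_snd).inner (hZ.aestronglyMeasurable.comp_fst)
  rw [memLp_two_iff_integrable_sq hm]
  have h1 : Integrable (fun p : Ω × Ω' => ‖Z p.1‖ ^ 2 * ‖S p.2‖ ^ 2) (P.prod ν) :=
    ((memLp_norm_sq hZ).integrable (by norm_num)).mul_prod
      ((memLp_norm_sq hS).integrable (by norm_num))
  refine h1.mono' (hm.pow 2) (Eventually.of_forall fun p => ?_)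
  rw [Real.norm_of_nonneg (sq_nonneg _), ← mul_pow, ← sq_abs]
  exact pow_le_pow_left₀ (abs_nonneg _) ((abs_real_inner_le_norm _ _).trans_eq (mul_comm _ _)) 2

variable [CompleteSpace H]

/-- A martingale step. For fixed `S` the increment 2⟨S,Z⟩ + (‖Z‖² - τ) has mean zero, so it is
orthogonal to `V` and contributes only its own second moment. In the induction `V` is ‖S‖² - nτ. -/
lemma integral_sq_step {P : Measure Ω} [IsProbabilityMeasure P] {ν : Measure Ω'}
    [IsProbabilityMeasure ν] {Z : Ω → H} {S : Ω' → H} {V : Ω' → ℝ} (hZ : MemLp Z 4 P)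
    (h0 : ∫ x, Z x ∂P = 0) (hS : MemLp S 4 ν) (hV : MemLp V 2 ν) :
    ∫ p, (V p.2 + (2 * inner ℝ (S p.2) (Z p.1) + (‖Z p.1‖ ^ 2 - ∫ y, ‖Z y‖ ^ 2 ∂P))) ^ 2
        ∂(P.prod ν) ≤
      ∫ ω, V ω ^ 2 ∂ν + 8 * (∫ x, ∫ ω, (inner ℝ (S ω) (Z x) : ℝ) ^ 2 ∂ν ∂P)
        + 2 * ∫ x, ‖Z x‖ ^ 4 ∂P := by
  set τ := ∫ y, ‖Z y‖ ^ 2 ∂P with hτ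
  have ha : MemLp (fun p : Ω × Ω' => V p.2) 2 (P.prod ν) := hV.comp_snd P
  have hi := memLp_inner_prod hZ hS
  have hc : MemLp (fun x => ‖Z x‖ ^ 2 - τ) 2 P := (memLp_norm_sq hZ).sub (memLp_const _)
  have hc' : MemLp (fun p : Ω × Ω' => ‖Z p.1‖ ^ 2 - τ) 2 (P.prod ν) := hc.comp_fst ν
  have hb : MemLp (fun p : Ω × Ω' => 2 * (inner ℝ (S p.2) (Z p.1) : ℝ) + (‖Z p.1‖ ^ 2 - τ)) 2
    (P.prod ν) := (hi.const_mul 2).add hc'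
  have hab : Integrable (fun p : Ω × Ω' => V p.2 *
      (2 * (inner ℝ (S p.2) (Z p.1) : ℝ) + (‖Z p.1‖ ^ 2 - τ))) (P.prod ν) :=
    ha.integrable_mul hb
  have hZ1 : Integrable Z P := hZ.integrable (by norm_num)
  have hcross : ∫ p, V p.2 * (2 * (inner ℝ (S p.2) (Z p.1) : ℝ) + (‖Z p.1‖ ^ 2 - τ))
      ∂(P.prod ν) = 0 := by
    rw [integral_prod_symm _ hab]
    refine integral_eq_zero_of_ae (Eventually.of_forall fun ω => ?_)
    simp only [Pi.zero_apply]
    rw [integral_const_mul, integral_add ((hZ1.const_inner (S ω)).const_mul 2)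
      (hc.integrable (by norm_num)), integral_const_mul, integral_inner hZ1, h0,
      integral_sub ((memLp_norm_sq hZ).integrable (by norm_num)) (integrable_const _)]
    simp [hτ]
  have hexp : ∫ p, (V p.2 + (2 * inner ℝ (S p.2) (Z p.1) + (‖Z p.1‖ ^ 2 - τ))) ^ 2 ∂(P.prod ν)
      = ∫ p, V p.2 ^ 2 ∂(P.prod ν)
        + ∫ p, (2 * (inner ℝ (S p.2) (Z p.1) : ℝ) + (‖Z p.1‖ ^ 2 - τ)) ^ 2 ∂(P.prod ν) := by
    rw [← integral_add ha.integrable_sq hb.integrable_sq]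
    have : ∀ p : Ω × Ω', (V p.2 + (2 * inner ℝ (S p.2) (Z p.1) + (‖Z p.1‖ ^ 2 - τ))) ^ 2 =
      (V p.2 ^ 2 + (2 * (inner ℝ (S p.2) (Z p.1) : ℝ) + (‖Z p.1‖ ^ 2 - τ)) ^ 2)
        + 2 * (V p.2 * (2 * (inner ℝ (S p.2) (Z p.1) : ℝ) + (‖Z p.1‖ ^ 2 - τ))) := fun p => by ring
    simp only [this]
    rw [integral_add (f := fun p : Ω × Ω' => V p.2 ^ 2 +
      (2 * (inner ℝ (S p.2) (Z p.1) : ℝ) + (‖Z p.1‖ ^ 2 - τ)) ^ 2)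
      (ha.integrable_sq.add hb.integrable_sq) (hab.const_mul 2), integral_const_mul, hcross]
    simp
  have hVV : ∫ p, V p.2 ^ 2 ∂(P.prod ν) = ∫ ω, V ω ^ 2 ∂ν := by
    rw [integral_fun_snd (fun ω => V ω ^ 2)]; simp
  have hbb : ∫ p, (2 * (inner ℝ (S p.2) (Z p.1) : ℝ) + (‖Z p.1‖ ^ 2 - τ)) ^ 2 ∂(P.prod ν)
      ≤ 8 * (∫ x, ∫ ω, (inner ℝ (S ω) (Z x) : ℝ) ^ 2 ∂ν ∂P) + 2 * ∫ x, ‖Z x‖ ^ 4 ∂P := by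
    have e1 : ∫ x, ∫ ω, (inner ℝ (S ω) (Z x) : ℝ) ^ 2 ∂ν ∂P
        = ∫ p, (inner ℝ (S p.2) (Z p.1) : ℝ) ^ 2 ∂(P.prod ν) :=
      (integral_prod _ hi.integrable_sq).symm
    have e2 : ∫ p, (‖Z p.1‖ ^ 2 - τ) ^ 2 ∂(P.prod ν) = ∫ x, (‖Z x‖ ^ 2 - τ) ^ 2 ∂P := by
      rw [integral_fun_fst (fun x => (‖Z x‖ ^ 2 - τ) ^ 2)]; simp
    have e3 := integral_centered_norm_sq_le hZ
    rw [← hτ] at e3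
    calc _ ≤ ∫ p, (8 * (inner ℝ (S p.2) (Z p.1) : ℝ) ^ 2 + 2 * (‖Z p.1‖ ^ 2 - τ) ^ 2)
          ∂(P.prod ν) := by
          refine integral_mono hb.integrable_sq
            ((hi.integrable_sq.const_mul 8).add (hc'.integrable_sq.const_mul 2)) fun p => ?_
          simp only
          nlinarith [sq_nonneg (2 * (inner ℝ (S p.2) (Z p.1) : ℝ) - (‖Z p.1‖ ^ 2 - τ))]
      _ ≤ _ := by
          rw [integral_add (hi.integrable_sq.const_mul 8) (hc'.integrable_sq.const_mul 2),
            integral_const_mul, integral_const_mul, e1, e2]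
          linarith
  rw [hexp, hVV]
  linarith

/-- The squared norm of a sum of iid centred vectors concentrates around its mean. -/
lemma integral_norm_sum_sq_sub_sq_le {P : Measure Ω} [IsProbabilityMeasure P] {Z : Ω → H}
    (hZ : MemLp Z 4 P) (h0 : ∫ x, Z x ∂P = 0) (n : ℕ) :
    ∫ ω, (‖∑ i, Z (ω i)‖ ^ 2 - n * ∫ y, ‖Z y‖ ^ 2 ∂P) ^ 2 ∂(Measure.pi fun _ : Fin n => P) ≤
      4 * n ^ 2 * (∫ x, ∫ y, (inner ℝ (Z y) (Z x) : ℝ) ^ 2 ∂P ∂P)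
        + 2 * n * ∫ x, ‖Z x‖ ^ 4 ∂P := by
  set τ := ∫ y, ‖Z y‖ ^ 2 ∂P with hτ
  have hB : 0 ≤ ∫ x, ∫ y, (inner ℝ (Z y) (Z x) : ℝ) ^ 2 ∂P ∂P := by positivity
  have hF : 0 ≤ ∫ x, ‖Z x‖ ^ 4 ∂P := by positivity
  -- The step from n to n + 1 adds 8nB + 2F, where B = E⟨Z,Z'⟩² and F = E‖Z‖⁴; and 8(0 + 1 + ... +
  -- (n - 1)) ≤ 4n².
  induction n with
  | zero => simp
  | succ n ih =>
    set ν := Measure.pi fun _ : Fin n => P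
    have hS := memLp_sum_pi hZ n
    have hV : MemLp (fun ω : Fin n → Ω => ‖∑ i, Z (ω i)‖ ^ 2 - n * τ) 2 ν :=
      (memLp_norm_sq hS).sub (memLp_const _)
    have hstep := integral_sq_step hZ h0 hS hV
    have hmp := measurePreserving_piFinSuccAbove (fun _ : Fin (n + 1) => P) 0
    have hint := hmp.integral_comp' (g := fun p : Ω × (Fin n → Ω) =>
      ((‖∑ i, Z (p.2 i)‖ ^ 2 - n * τ) + (2 * inner ℝ (∑ i, Z (p.2 i)) (Z p.1)
        + (‖Z p.1‖ ^ 2 - τ))) ^ 2)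
    have hfib : ∀ x, ∫ ω, (inner ℝ (∑ i, Z (ω i)) (Z x) : ℝ) ^ 2 ∂ν
        = n * ∫ y, (inner ℝ (Z y) (Z x) : ℝ) ^ 2 ∂P := fun x => by
      have hX : MemLp (fun y => (inner ℝ (Z y) (Z x) : ℝ)) 2 P := by
        have := (hZ.mono_exponent (p := 2) (by norm_num)).const_inner (𝕜 := ℝ) (Z x)
        simpa only [real_inner_comm] using this
      have hX0 : ∫ y, (inner ℝ (Z y) (Z x) : ℝ) ∂P = 0 := by
        have := integral_inner (𝕜 := ℝ) (hZ.integrable (by norm_num)) (Z x)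
        simp only [h0, inner_zero_right] at this
        simpa only [real_inner_comm] using this
      rw [← integral_sum_sq_pi P hX hX0 n]
      simp only [sum_inner]
      rfl
    rw [integral_congr_ae (Eventually.of_forall hfib)] at hstep
    rw [integral_const_mul] at hstep
    have hcongr : ∀ ω : Fin (n + 1) → Ω,
        (‖∑ i, Z (ω i)‖ ^ 2 - (n + 1 : ℕ) * τ) ^ 2 =
        ((‖∑ i : Fin n, Z (ω i.succ)‖ ^ 2 - n * τ) + (2 * inner ℝ (∑ i : Fin n, Z (ω i.succ))
          (Z (ω 0)) + (‖Z (ω 0)‖ ^ 2 - τ))) ^ 2 := fun ω => by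
      rw [Fin.sum_univ_succ, add_comm, norm_add_sq_real]
      push_cast; ring
    rw [integral_congr_ae (Eventually.of_forall hcongr)]
    refine (hint.trans_le hstep).trans ?_
    push_cast
    nlinarith
end Hilbert

/-! ### Isotropic laws and the matrix y yᵀ - 1. -/

/-- A centred isotropic distribution whose marginals have sub-Gaussian moments up to order `8`. -/
structure IsWhite {d : ℕ} (κ : ℝ) (ν : Measure (E d)) : Prop where
  memLp : MemLp (fun y : E d => y) 8 ν
  mean : ∀ b : E d, ∫ y, (inner ℝ b y : ℝ) ∂ν = 0
  second : ∀ b : E d, ∫ y, (inner ℝ b y : ℝ) ^ 2 ∂ν = ‖b‖ ^ 2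
  fourth : ∀ b : E d, ∫ y, (inner ℝ b y : ℝ) ^ 4 ∂ν ≤ 16 * κ ^ 4 * ‖b‖ ^ 4
  sixth : ∀ b : E d, ∫ y, (inner ℝ b y : ℝ) ^ 6 ∂ν ≤ 216 * κ ^ 6 * ‖b‖ ^ 6
  eighth : ∀ b : E d, ∫ y, (inner ℝ b y : ℝ) ^ 8 ∂ν ≤ 4096 * κ ^ 8 * ‖b‖ ^ 8

/-- The matrix `y yᵀ - 1`, as a vector for the Frobenius norm. -/
def outerSubOne {d : ℕ} (y : E d) : EuclideanSpace ℝ (Fin d × Fin d) :=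
  WithLp.toLp 2 fun p => y p.1 * y p.2 - if p.1 = p.2 then 1 else 0

lemma inner_eq_sum {ι : Type*} [Fintype ι] (x y : EuclideanSpace ℝ ι) :
    (inner ℝ x y : ℝ) = ∑ i, x i * y i := by
  simp [PiLp.inner_apply, mul_comm]

lemma inner_outerSubOne {d : ℕ} (x y : E d) :
    (inner ℝ (outerSubOne x) (outerSubOne y) : ℝ) =
      (inner ℝ x y : ℝ) ^ 2 - ‖x‖ ^ 2 - ‖y‖ ^ 2 + d := by
  have h : ∀ a b : Fin d, (x a * x b - if a = b then 1 else 0) * (y a * y b - if a = b then 1 else 0)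
      = (x a * y a) * (x b * y b) - (if a = b then x a * x a else 0)
        - (if a = b then y a * y a else 0) + (if a = b then (1 : ℝ) else 0) := by
    intro a b
    by_cases h : a = b
    · subst h; simp; ring
    · simp [h]; ring
  rw [inner_eq_sum, Fintype.sum_prod_type, ← real_inner_self_eq_norm_sq,
    ← real_inner_self_eq_norm_sq, inner_eq_sum, inner_eq_sum, inner_eq_sum, sq, Finset.sum_mul_sum]
  simp only [outerSubOne, h, Finset.sum_add_distrib, Finset.sum_sub_distrib]
  simp

lemma continuous_outerSubOne {d : ℕ} : Continuous (outerSubOne (d := d)) := by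
  unfold outerSubOne
  refine (PiLp.continuous_toLp 2 _).comp (continuous_pi fun p => ?_)
  fun_prop

lemma norm_outerSubOne_sq {d : ℕ} (y : E d) :
    ‖outerSubOne y‖ ^ 2 = ‖y‖ ^ 4 - 2 * ‖y‖ ^ 2 + d := by
  rw [← real_inner_self_eq_norm_sq, inner_outerSubOne, real_inner_self_eq_norm_sq]; ring

lemma norm_outerSubOne_le {d : ℕ} (y : E d) : ‖outerSubOne y‖ ≤ ‖y‖ ^ 2 + d := by
  refine le_of_sq_le_sq ?_ (by positivity)
  rw [norm_outerSubOne_sq]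
  have : (d : ℝ) ≤ d ^ 2 := by exact_mod_cast Nat.le_self_pow (by norm_num) d
  nlinarith [mul_nonneg (sq_nonneg ‖y‖) (Nat.cast_nonneg (α := ℝ) d), sq_nonneg ‖y‖]

/-- The left side is the Frobenius inner product of b bᵀ with the sum of matrices, and b bᵀ has
Frobenius norm ‖b‖². A single matrix event thus bounds the second moment in every direction, with no
net on the sphere. -/
lemma sum_inner_sq_sub_le {d : ℕ} {ι : Type*} (s : Finset ι) (y : ι → E d) (b : E d) :
    ∑ i ∈ s, ((inner ℝ b (y i) : ℝ) ^ 2 - ‖b‖ ^ 2) ≤ ‖b‖ ^ 2 * ‖∑ i ∈ s, outerSubOne (y i)‖ := by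
  set bb : EuclideanSpace ℝ (Fin d × Fin d) := WithLp.toLp 2 fun p => b p.1 * b p.2 with hbb
  have h1 : ∀ z : E d, (inner ℝ bb (outerSubOne z) : ℝ) = (inner ℝ b z : ℝ) ^ 2 - ‖b‖ ^ 2 := by
    intro z
    have h : ∀ p q : Fin d, b p * b q * (z p * z q - if p = q then 1 else 0)
        = (b p * z p) * (b q * z q) - (if p = q then b p * b p else 0) := by
      intro p q
      by_cases h : p = q
      · subst h; simp; ring
      · simp [h]; ring
    rw [inner_eq_sum, Fintype.sum_prod_type, ← real_inner_self_eq_norm_sq, inner_eq_sum,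
      inner_eq_sum, sq, Finset.sum_mul_sum]
    simp only [hbb, outerSubOne, h, Finset.sum_sub_distrib]
    simp
  have h2 : ‖bb‖ = ‖b‖ ^ 2 := by
    rw [← sq_eq_sq₀ (norm_nonneg _) (sq_nonneg _), ← real_inner_self_eq_norm_sq, inner_eq_sum,
      Fintype.sum_prod_type, ← real_inner_self_eq_norm_sq, inner_eq_sum, sq, Finset.sum_mul_sum]
    refine Finset.sum_congr rfl fun p _ => Finset.sum_congr rfl fun q _ => ?_
    simp only [hbb]; ring
  calc _ = (inner ℝ bb (∑ i ∈ s, outerSubOne (y i)) : ℝ) := by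
        rw [inner_sum]; simp only [h1]
    _ ≤ _ := (real_inner_le_norm _ _).trans_eq (by rw [h2])

namespace IsWhite

variable {d : ℕ} {κ : ℝ} {ν : Measure (E d)} [IsProbabilityMeasure ν]

lemma integrable_norm_pow (h : IsWhite κ ν) {k : ℕ} (hk : k ≤ 8) :
    Integrable (fun y : E d => ‖y‖ ^ k) ν :=
  (h.memLp.mono_exponent (p := k) (by exact_mod_cast hk)).integrable_norm_pow'

lemma integrable_inner_pow (h : IsWhite κ ν) (b : E d) {k : ℕ} (hk : k ≤ 8) :
    Integrable (fun y : E d => (inner ℝ b y : ℝ) ^ k) ν := by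
  refine ((h.integrable_norm_pow hk).const_mul (‖b‖ ^ k)).mono'
    (by fun_prop) (Eventually.of_forall fun y => ?_)
  rw [norm_pow, ← mul_pow]
  exact pow_le_pow_left₀ (norm_nonneg _) (norm_inner_le_norm _ _) k

lemma integral_norm_sq (h : IsWhite κ ν) : ∫ y, ‖y‖ ^ 2 ∂ν = d := by
  have e : ∀ y : E d, ‖y‖ ^ 2 = ∑ j, (inner ℝ (EuclideanSpace.single j (1 : ℝ)) y : ℝ) ^ 2 := by
    intro y
    rw [EuclideanSpace.real_norm_sq_eq]; simp [EuclideanSpace.inner_single_left]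
  simp only [e]
  rw [integral_finsetSum _ fun j _ => h.integrable_inner_pow _ (by norm_num)]
  simp [h.second]

/-- The power mean inequality over the d coordinates reduces the norm to one-dimensional marginals.
-/
lemma integral_norm_pow_le (h : IsWhite κ ν) {q : ℝ} {k : ℕ} (hk : 2 * (k + 1) ≤ 8)
    (hq : ∀ b : E d, ∫ y, (inner ℝ b y : ℝ) ^ (2 * (k + 1)) ∂ν ≤ q * ‖b‖ ^ (2 * (k + 1))) :
    ∫ y, ‖y‖ ^ (2 * (k + 1)) ∂ν ≤ q * d ^ (k + 1) := by
  have e : ∀ y : E d, ‖y‖ ^ (2 * (k + 1)) ≤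
      d ^ k * ∑ j, (inner ℝ (EuclideanSpace.single j (1 : ℝ)) y : ℝ) ^ (2 * (k + 1)) := by
    intro y
    rcases Nat.eq_zero_or_pos d with rfl | hd
    · have : ‖y‖ = 0 := by rw [Subsingleton.elim y 0]; simp
      simp [this]
    have h1 := pow_sum_div_card_le_sum_pow (s := Finset.univ) (f := fun j => y j ^ 2)
      (fun j _ => sq_nonneg _) k
    rw [div_le_iff₀ (by simp; positivity)] at h1
    rw [pow_mul, EuclideanSpace.real_norm_sq_eq]
    refine h1.trans_eq ?_
    simp [mul_comm, EuclideanSpace.inner_single_left, ← pow_mul]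
  calc _ ≤ ∫ y, d ^ k * ∑ j, (inner ℝ (EuclideanSpace.single j (1 : ℝ)) y : ℝ) ^ (2 * (k + 1)) ∂ν :=
        integral_mono (h.integrable_norm_pow hk) ((integrable_finsetSum _ fun j _ =>
          h.integrable_inner_pow _ hk).const_mul _) e
    _ ≤ d ^ k * ∑ j : Fin d, q := by
        rw [integral_const_mul, integral_finsetSum _ fun j _ => h.integrable_inner_pow _ hk]
        gcongr with j
        simpa using hq (EuclideanSpace.single j (1 : ℝ))
    _ = _ := by simp; ring

lemma integral_inner_mul_inner (h : IsWhite κ ν) (a b : E d) :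
    ∫ y, (inner ℝ a y : ℝ) * inner ℝ b y ∂ν = inner ℝ a b := by
  have e : ∀ y : E d, (inner ℝ a y : ℝ) * inner ℝ b y =
      2⁻¹ * ((inner ℝ (a + b) y : ℝ) ^ 2 - (inner ℝ a y : ℝ) ^ 2 - (inner ℝ b y : ℝ) ^ 2) := by
    intro y; rw [inner_add_left]; ring
  simp only [e]
  have i := fun c => h.integrable_inner_pow c (k := 2) (by norm_num)
  rw [integral_const_mul, integral_sub ((i _).sub' (i _)) (i _), integral_sub (i _) (i _),
    h.second, h.second, h.second, norm_add_sq_real]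
  ring

/-- The matrix is quadratic in y, so its fourth moment needs the eighth moment of y. -/
lemma memLp_outerSubOne (h : IsWhite κ ν) : MemLp (outerSubOne (d := d)) 4 ν := by
  have h1 : MemLp (fun y : E d => ‖y‖ ^ 2) 4 ν := by
    have := h.memLp.norm_rpow_div 2
    have e : (8 / 2 : ℝ≥0∞) = 4 := by
      rw [show (8 : ℝ≥0∞) = 4 * 2 by norm_num]; exact ENNReal.mul_div_cancel_right (by norm_num) (by norm_num)
    rw [e] at this
    simpa using this
  refine (h1.add (memLp_const (d : ℝ))).mono' continuous_outerSubOne.aestronglyMeasurable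
    (Eventually.of_forall fun y => norm_outerSubOne_le y)

lemma integral_outerSubOne (h : IsWhite κ ν) : ∫ y, outerSubOne y ∂ν = 0 := by
  have hi := h.memLp_outerSubOne.integrable (by norm_num)
  ext p
  have h1 := (EuclideanSpace.proj (𝕜 := ℝ) p).integral_comp_comm hi
  have h2 : ∫ y, (EuclideanSpace.proj (𝕜 := ℝ) p) (outerSubOne y) ∂ν = 0 := by
    have e : ∀ y : E d, (EuclideanSpace.proj (𝕜 := ℝ) p) (outerSubOne y) =
        (inner ℝ (EuclideanSpace.single p.1 (1 : ℝ)) y : ℝ) *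
          inner ℝ (EuclideanSpace.single p.2 (1 : ℝ)) y - if p.1 = p.2 then 1 else 0 := by
      intro y; simp [outerSubOne, EuclideanSpace.inner_single_left]
    have hi2 := (EuclideanSpace.proj (𝕜 := ℝ) p).integrable_comp hi
    simp only [e] at hi2 ⊢
    have hi3 := hi2.fun_add (integrable_const (if p.1 = p.2 then (1 : ℝ) else 0))
    rw [integral_sub (by simpa only [sub_add_cancel] using hi3) (integrable_const _), h.integral_inner_mul_inner]
    simp [EuclideanSpace.inner_single_left]
  rw [h2] at h1
  simpa using h1.symm

lemma integral_norm_outerSubOne_sq_le (h : IsWhite κ ν) :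
    ∫ y, ‖outerSubOne y‖ ^ 2 ∂ν ≤ 16 * κ ^ 4 * d ^ 2 := by
  have h4 := h.integral_norm_pow_le (k := 1) (by norm_num) h.fourth
  have i4 := h.integrable_norm_pow (k := 4) (by norm_num)
  have i2 := h.integrable_norm_pow (k := 2) (by norm_num)
  simp only [norm_outerSubOne_sq]
  rw [integral_add (i4.sub' (i2.const_mul 2)) (integrable_const _),
    integral_sub i4 (i2.const_mul 2), integral_const_mul, h.integral_norm_sq]
  simp only [integral_const, probReal_univ, one_smul]
  norm_num at h4
  linarith [Nat.cast_nonneg (α := ℝ) d]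

lemma integral_norm_outerSubOne_pow_four_le (h : IsWhite κ ν) :
    ∫ y, ‖outerSubOne y‖ ^ 4 ∂ν ≤ 2 * (4096 * κ ^ 8 * d ^ 4 + d ^ 2) := by
  have h8 := h.integral_norm_pow_le (k := 3) (by norm_num) h.eighth
  have i8 := h.integrable_norm_pow (k := 8) (by norm_num)
  norm_num at h8
  calc ∫ y, ‖outerSubOne y‖ ^ 4 ∂ν ≤ ∫ y, 2 * (‖y‖ ^ 8 + d ^ 2) ∂ν := by
        refine integral_mono (h.memLp_outerSubOne.integrable_norm_pow (p := 4) (by norm_num))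
          ((i8.add (integrable_const _)).const_mul 2) fun y => ?_
        have e1 : ‖outerSubOne y‖ ^ 4 = (‖y‖ ^ 4 - 2 * ‖y‖ ^ 2 + d) ^ 2 := by
          rw [← norm_outerSubOne_sq]; ring
        have e2 : 0 ≤ ‖y‖ ^ 4 - 2 * ‖y‖ ^ 2 + d := by
          rw [← norm_outerSubOne_sq]; positivity
        have e3 : (‖y‖ ^ 4 - 2 * ‖y‖ ^ 2 + d) ^ 2 ≤ (‖y‖ ^ 4 + d) ^ 2 :=
          pow_le_pow_left₀ e2 (by nlinarith [sq_nonneg ‖y‖]) 2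
        simp only
        nlinarith [sq_nonneg (‖y‖ ^ 4 - d)]
    _ ≤ _ := by
        rw [integral_const_mul, integral_add i8 (integrable_const _)]
        simp only [integral_const, probReal_univ, one_smul]
        linarith

/-- Cauchy-Schwarz for u and u³, obtained from the discriminant of t ↦ E(tu - u³)². Isotropy makes E
u² free of κ, which saves a factor κ² over squaring the bound on the fourth moment. -/
lemma integral_inner_pow_four_le_of_sq (h : IsWhite κ ν) (b : E d) :
    (∫ y, (inner ℝ b y : ℝ) ^ 4 ∂ν) ^ 2 ≤ 216 * κ ^ 6 * ‖b‖ ^ 8 := by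
  set I := ∫ y, (inner ℝ b y : ℝ) ^ 4 ∂ν
  have i := fun k hk => h.integrable_inner_pow b (k := k) hk
  have key : ∀ t : ℝ, 0 ≤ ‖b‖ ^ 2 * (t * t) + (-2 * I) * t + 216 * κ ^ 6 * ‖b‖ ^ 6 := by
    intro t
    have h0 : 0 ≤ ∫ y, (t * (inner ℝ b y : ℝ) - (inner ℝ b y : ℝ) ^ 3) ^ 2 ∂ν :=
      integral_nonneg fun y => sq_nonneg _
    have e : ∀ y : E d, (t * (inner ℝ b y : ℝ) - (inner ℝ b y : ℝ) ^ 3) ^ 2 =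
        t * t * (inner ℝ b y : ℝ) ^ 2 - 2 * t * (inner ℝ b y : ℝ) ^ 4
          + (inner ℝ b y : ℝ) ^ 6 := fun y => by ring
    simp only [e] at h0
    rw [integral_add (((i 2 (by norm_num)).const_mul _).sub' ((i 4 (by norm_num)).const_mul _))
      (i 6 (by norm_num)), integral_sub ((i 2 (by norm_num)).const_mul _)
      ((i 4 (by norm_num)).const_mul _), integral_const_mul, integral_const_mul, h.second] at h0
    have := h.sixth b
    nlinarith
  have := discrim_le_zero key
  unfold discrim at this
  nlinarith

/-- In ⟨x,y⟩² - ‖x‖² - ‖y‖² + d each term has mean square at most Q²d². Bounding the inner product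
by the product of the norms would cost d⁴. -/
lemma integral_inner_outerSubOne_sq_le (h : IsWhite κ ν) {Q : ℝ} (hQ1 : 1 ≤ Q)
    (hQ : ∀ b : E d, ∫ y, (inner ℝ b y : ℝ) ^ 4 ∂ν ≤ Q * ‖b‖ ^ 4) :
    ∫ x, ∫ y, (inner ℝ (outerSubOne y) (outerSubOne x) : ℝ) ^ 2 ∂ν ∂ν ≤ 16 * Q ^ 2 * d ^ 2 := by
  have h4 := h.integral_norm_pow_le (k := 1) (by norm_num) hQ
  norm_num at h4
  have i4 := h.integrable_norm_pow (k := 4) (by norm_num)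
  have hin : ∀ x : E d, ∫ y, (inner ℝ (outerSubOne y) (outerSubOne x) : ℝ) ^ 2 ∂ν ≤
      4 * ((Q + 1) * ‖x‖ ^ 4 + (Q + 1) * d ^ 2) := by
    intro x
    have ix := h.integrable_inner_pow x (k := 4) (by norm_num)
    calc _ ≤ ∫ y, 4 * ((inner ℝ x y : ℝ) ^ 4 + ‖y‖ ^ 4 + (‖x‖ ^ 4 + d ^ 2)) ∂ν := by
          refine integral_mono
            (by simpa only [real_inner_comm] using ((h.memLp_outerSubOne.mono_exponent (p := 2)
              (by norm_num)).const_inner (𝕜 := ℝ) (outerSubOne x)).integrable_sq) (((ix.fun_add i4).add (integrable_const _)).const_mul 4) fun y => ?_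
          simp only [inner_outerSubOne]
          rw [real_inner_comm x y]
          set u := (inner ℝ x y : ℝ) ^ 2 with hu
          have : (inner ℝ x y : ℝ) ^ 4 = u ^ 2 := by rw [hu]; ring
          rw [this]
          nlinarith [sq_nonneg (u + ‖y‖ ^ 2), sq_nonneg (u + ‖x‖ ^ 2), sq_nonneg (u - d),
            sq_nonneg (‖y‖ ^ 2 - ‖x‖ ^ 2), sq_nonneg (‖y‖ ^ 2 + d), sq_nonneg (‖x‖ ^ 2 + d)]
      _ ≤ _ := by
          rw [integral_const_mul, integral_add (ix.fun_add i4) (integrable_const _),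
            integral_add ix i4]
          simp only [integral_const, probReal_univ, one_smul]
          linarith [hQ x]
  have hint : Integrable (fun x : E d => 4 * ((Q + 1) * ‖x‖ ^ 4 + (Q + 1) * (d : ℝ) ^ 2)) ν :=
    ((i4.const_mul _).add (integrable_const _)).const_mul _
  refine (integral_mono_of_nonneg (Eventually.of_forall fun x =>
    integral_nonneg fun y => sq_nonneg _) hint (Eventually.of_forall hin)).trans ?_
  rw [integral_const_mul, integral_add (i4.const_mul _) (integrable_const _), integral_const_mul]
  simp only [integral_const, probReal_univ, one_smul]
  have hd : (0 : ℝ) ≤ (d : ℝ) ^ 2 := by positivity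
  nlinarith [mul_le_mul_of_nonneg_left h4 (show (0 : ℝ) ≤ Q + 1 by linarith),
    mul_nonneg hd (show 0 ≤ (Q - 1) by linarith), mul_nonneg hd (show 0 ≤ (Q - 1) * Q by nlinarith)]

/-- E u⁴ ≥ (E u²)² = 1 for a unit direction. This gives 1 ≤ 16κ⁴, so lower-order terms can be
absorbed into powers of κ. -/
lemma one_le_of_pow_four (h : IsWhite κ ν) (hd : 1 ≤ d) {Q : ℝ}
    (hQ : ∀ b : E d, ∫ y, (inner ℝ b y : ℝ) ^ 4 ∂ν ≤ Q * ‖b‖ ^ 4) : 1 ≤ Q := by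
  set b : E d := EuclideanSpace.single ⟨0, hd⟩ (1 : ℝ)
  have hb : ‖b‖ = 1 := by simp [b]
  have h1 := hQ b
  have h0 : 0 ≤ ∫ y, ((inner ℝ b y : ℝ) ^ 2 - 1) ^ 2 ∂ν := integral_nonneg fun y => sq_nonneg _
  have e : ∀ y : E d, ((inner ℝ b y : ℝ) ^ 2 - 1) ^ 2 =
      (inner ℝ b y : ℝ) ^ 4 - 2 * (inner ℝ b y : ℝ) ^ 2 + 1 := fun y => by ring
  have i := fun k hk => h.integrable_inner_pow b (k := k) hk
  simp only [e] at h0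
  rw [integral_add ((i 4 (by norm_num)).sub' ((i 2 (by norm_num)).const_mul _)) (integrable_const _),
    integral_sub (i 4 (by norm_num)) ((i 2 (by norm_num)).const_mul _), integral_const_mul,
    h.second, hb] at h0
  simp only [integral_const, probReal_univ, one_smul] at h0
  rw [hb] at h1
  linarith

end IsWhite

/-! ### Moment estimates for a random cluster. -/

/-- Given the event `A` of probability `w`, the random vector `Y` has law `ν`. -/
structure HasLawOn {Ω : Type*} [MeasurableSpace Ω] {d : ℕ} (P : Measure Ω) (A : Set Ω) (Y : Ω → E d)
    (w : ℝ) (ν : Measure (E d)) : Prop where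
  measurableSet : MeasurableSet A
  measurable : Measurable Y
  pos : 0 < w
  map_eq : (P.restrict A).map Y = ENNReal.ofReal w • ν

/-- A sum over the random cluster becomes a sum of iid terms over all indices. -/
lemma sum_indicator {Ω G : Type*} [AddCommMonoid G] {A : Set Ω} {n : ℕ} {C : Finset (Fin n)} {ω : Fin n → Ω} (hC : ∀ i, i ∈ C ↔ ω i ∈ A)
    (g : Ω → G) : ∑ i, A.indicator g (ω i) = ∑ i ∈ C, g (ω i) := by
  classical
  have : C = Finset.univ.filter fun i => ω i ∈ A := by ext i; simp [hC]
  rw [this, Finset.sum_filter]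
  exact Finset.sum_congr rfl fun i _ => by simp [Set.indicator_apply]

namespace HasLawOn

variable {Ω : Type*} [MeasurableSpace Ω] {d : ℕ} {P : Measure Ω} {A : Set Ω} {Y : Ω → E d}
    {w : ℝ} {ν : Measure (E d)} {G : Type*} [NormedAddCommGroup G]

lemma real_inter_preimage (h : HasLawOn P A Y w ν) {B : Set (E d)} (hB : MeasurableSet B) :
    P.real (A ∩ Y ⁻¹' B) = w * ν.real B := by
  have h1 : ((P.restrict A).map Y).real B = (ENNReal.ofReal w • ν).real B := by rw [h.map_eq]
  rw [map_measureReal_apply h.measurable hB,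
    measureReal_restrict_apply (h.measurable hB), measureReal_ennreal_smul_apply,
    ENNReal.toReal_ofReal h.pos.le, Set.inter_comm] at h1
  exact h1

lemma real_eq [IsProbabilityMeasure ν] (h : HasLawOn P A Y w ν) : P.real A = w := by
  simpa using h.real_inter_preimage MeasurableSet.univ

lemma integral_indicator [NormedSpace ℝ G] (h : HasLawOn P A Y w ν) {g : E d → G}
    (hg : AEStronglyMeasurable g ν) :
    ∫ ω, A.indicator (fun ω => g (Y ω)) ω ∂P = w • ∫ y, g y ∂ν := by
  rw [MeasureTheory.integral_indicator h.measurableSet, ← integral_map (φ := Y) (f := g)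
    h.measurable.aemeasurable (by rw [h.map_eq]; exact hg.smul_measure _), h.map_eq,
    integral_smul_measure, ENNReal.toReal_ofReal h.pos.le]

lemma memLp_indicator (h : HasLawOn P A Y w ν) {g : E d → G} {p : ℝ≥0∞} (hg : MemLp g p ν) :
    MemLp (A.indicator fun ω => g (Y ω)) p P := by
  rw [memLp_indicator_iff_restrict h.measurableSet]
  have h1 : MemLp g p ((P.restrict A).map Y) := by
    rw [h.map_eq]; exact hg.smul_measure ENNReal.ofReal_ne_top
  exact h1.comp_of_map h.measurable.aemeasurable

variable [IsProbabilityMeasure P] [IsProbabilityMeasure ν] {n : ℕ}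

lemma real_card_sub_le (h : HasLawOn P A Y w ν) (hn : 0 < n) {C : (Fin n → Ω) → Finset (Fin n)}
    (hC : ∀ ω i, i ∈ C ω ↔ ω i ∈ A) :
    (Measure.pi fun _ : Fin n => P).real {ω | n * w / 10 ≤ |((C ω).card : ℝ) - n * w|}
      ≤ 100 / (n * w) := by
  have hw := h.pos
  have hm : 0 < n * w := by positivity
  set X : Ω → ℝ := fun ω => A.indicator (fun _ => 1) ω - w with hX
  have hi : MemLp (A.indicator fun _ => (1 : ℝ)) 2 P :=
    memLp_indicator_const 2 h.measurableSet 1 (Or.inr (measure_ne_top _ _))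
  have hX2 : MemLp X 2 P := hi.sub (memLp_const w)
  have hind : ∫ ω, A.indicator (fun _ => (1 : ℝ)) ω ∂P = w := by
    rw [MeasureTheory.integral_indicator h.measurableSet]; simp [h.real_eq]
  have hX0 : ∫ ω, X ω ∂P = 0 := by
    rw [hX, integral_sub (hi.integrable (by norm_num)) (integrable_const _), hind]; simp
  have hXsq : ∫ ω, X ω ^ 2 ∂P ≤ w := by
    have e : ∀ ω, X ω ^ 2 = (1 - 2 * w) * A.indicator (fun _ => (1 : ℝ)) ω + w ^ 2 := by
      intro ω
      by_cases hω : ω ∈ A <;> simp [hX, hω]; ring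
    simp only [e]
    rw [integral_add ((hi.integrable (by norm_num)).const_mul _) (integrable_const _),
      integral_const_mul, hind]
    simp; nlinarith
  have hsum := integral_sum_sq_pi P hX2 hX0 n
  have hS : ∀ ω : Fin n → Ω, ∑ i, X (ω i) = ((C ω).card : ℝ) - n * w := by
    intro ω
    simp only [hX, Finset.sum_sub_distrib, sum_indicator (hC ω)]
    simp
  have h1 := mul_meas_ge_le_integral_of_nonneg (μ := Measure.pi fun _ : Fin n => P)
    (f := fun ω => (∑ i, X (ω i)) ^ 2) (Eventually.of_forall fun ω => sq_nonneg _)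
    (memLp_sum_pi hX2 n).integrable_sq ((n * w / 10) ^ 2)
  have hset : {ω : Fin n → Ω | n * w / 10 ≤ |((C ω).card : ℝ) - n * w|} =
      {ω | (n * w / 10) ^ 2 ≤ (∑ i, X (ω i)) ^ 2} := by
    ext ω
    simp only [Set.mem_ofPred_eq, hS]
    rw [sq_le_sq, abs_of_pos (by positivity : 0 < n * w / 10)]
  rw [← hset, hsum] at h1
  rw [le_div_iff₀ hm]
  have h2 : (n * w / 10) ^ 2 * (Measure.pi fun _ : Fin n => P).real
      {ω | n * w / 10 ≤ |((C ω).card : ℝ) - n * w|} ≤ n * w :=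
    h1.trans (mul_le_mul_of_nonneg_left hXsq (by positivity))
  set p := (Measure.pi fun _ : Fin n => P).real {ω | n * w / 10 ≤ |((C ω).card : ℝ) - n * w|}
  have h3 : (n * w) * (p * (n * w)) ≤ (n * w) * 100 := by nlinarith
  exact le_of_mul_le_mul_left h3 hm

lemma real_norm_sum_le {κ : ℝ} (h : HasLawOn P A Y w ν) (hν : IsWhite κ ν) (hn : 0 < n)
    {C : (Fin n → Ω) → Finset (Fin n)} (hC : ∀ ω i, i ∈ C ω ↔ ω i ∈ A) :
    (Measure.pi fun _ : Fin n => P).real {ω | n * w ≤ ‖∑ i ∈ C ω, Y (ω i)‖} ≤ d / (n * w) := by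
  have hw := h.pos
  have hm : 0 < n * w := by positivity
  set X : Fin d → Ω → ℝ := fun j => A.indicator fun ω => (Y ω) j with hX
  have hc : ∀ j, MemLp (fun y : E d => y j) 2 ν := fun j => by
    have := (hν.memLp.mono_exponent (p := 2) (by norm_num)).const_inner (𝕜 := ℝ)
      (EuclideanSpace.single j (1 : ℝ))
    simpa [EuclideanSpace.inner_single_left] using this
  have hX2 : ∀ j, MemLp (X j) 2 P := fun j => h.memLp_indicator (hc j)
  have hX0 : ∀ j, ∫ ω, X j ω ∂P = 0 := fun j => by
    rw [hX, h.integral_indicator (g := fun y => y j) (hc j).aestronglyMeasurable]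
    have := hν.mean (EuclideanSpace.single j (1 : ℝ))
    simp only [EuclideanSpace.inner_single_left, map_one, one_mul] at this
    simp [this]
  have hXsq : ∀ j, ∫ ω, X j ω ^ 2 ∂P = w := fun j => by
    have e : ∀ ω, X j ω ^ 2 = A.indicator (fun ω => ((Y ω) j) ^ 2) ω := fun ω => by
      by_cases hω : ω ∈ A <;> simp [hX, hω]
    simp only [e]
    rw [h.integral_indicator (g := fun y => y j ^ 2) (hc j).integrable_sq.aestronglyMeasurable]
    have := hν.second (EuclideanSpace.single j (1 : ℝ))
    simp only [EuclideanSpace.inner_single_left, map_one, one_mul] at this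
    simp [this]
  have hS : ∀ ω : Fin n → Ω, ‖∑ i ∈ C ω, Y (ω i)‖ ^ 2 = ∑ j, (∑ i, X j (ω i)) ^ 2 := by
    intro ω
    rw [EuclideanSpace.real_norm_sq_eq]
    refine Finset.sum_congr rfl fun j _ => ?_
    rw [hX, sum_indicator (hC ω)]
    simp
  have hint : ∀ j, Integrable (fun ω : Fin n → Ω => (∑ i, X j (ω i)) ^ 2)
      (Measure.pi fun _ => P) := fun j => (memLp_sum_pi (hX2 j) n).integrable_sq
  have h1 := mul_meas_ge_le_integral_of_nonneg (μ := Measure.pi fun _ : Fin n => P)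
    (f := fun ω => ∑ j, (∑ i, X j (ω i)) ^ 2) (Eventually.of_forall fun ω =>
      Finset.sum_nonneg fun j _ => sq_nonneg _) (integrable_finsetSum _ fun j _ => hint j)
      ((n * w) ^ 2)
  have hset : {ω : Fin n → Ω | n * w ≤ ‖∑ i ∈ C ω, Y (ω i)‖} =
      {ω | (n * w) ^ 2 ≤ ∑ j, (∑ i, X j (ω i)) ^ 2} := by
    ext ω
    simp only [Set.mem_ofPred_eq, ← hS]
    rw [sq_le_sq₀ hm.le (norm_nonneg _)]
  rw [← hset, integral_finsetSum _ fun j _ => hint j] at h1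
  simp only [fun j => integral_sum_sq_pi P (hX2 j) (hX0 j) n, hXsq] at h1
  simp only [Finset.sum_const, Finset.card_univ, Fintype.card_fin, nsmul_eq_mul] at h1
  rw [le_div_iff₀ hm]
  refine le_of_mul_le_mul_left (a := n * w) ?_ hm
  linarith

/-- The hypothesis `hκ` keeps the mean of the squared norm below (nw)², so a norm of at least 2nw is
a deviation of at least 3(nw)² from that mean. Chebyshev's inequality then uses the fluctuation of
the squared norm, not its size. -/
lemma real_norm_sum_outer_le {κ Q : ℝ} (h : HasLawOn P A Y w ν) (hν : IsWhite κ ν) (hn : 0 < n)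
    {C : (Fin n → Ω) → Finset (Fin n)} (hC : ∀ ω i, i ∈ C ω ↔ ω i ∈ A) (hQ1 : 1 ≤ Q)
    (hQ : ∀ b : E d, ∫ y, (inner ℝ b y : ℝ) ^ 4 ∂ν ≤ Q * ‖b‖ ^ 4)
    (hκ : 16 * κ ^ 4 * d ^ 2 ≤ n * w) :
    9 * (n * w) ^ 4 * (Measure.pi fun _ : Fin n => P).real
        {ω | 2 * (n * w) ≤ ‖∑ i ∈ C ω, outerSubOne (Y (ω i))‖} ≤
      64 * (n * w) ^ 2 * (Q ^ 2 * d ^ 2) + 4 * (n * w) * (4096 * κ ^ 8 * d ^ 4 + d ^ 2) := by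
  have hw := h.pos
  have hm : 0 < n * w := by positivity
  set Z : Ω → EuclideanSpace ℝ (Fin d × Fin d) := A.indicator fun ω => outerSubOne (Y ω) with hZ
  have hZ4 : MemLp Z 4 P := h.memLp_indicator hν.memLp_outerSubOne
  have hZ0 : ∫ ω, Z ω ∂P = 0 := by
    rw [hZ, h.integral_indicator (g := outerSubOne) hν.memLp_outerSubOne.aestronglyMeasurable,
      hν.integral_outerSubOne, smul_zero]
  have hco : Continuous fun y : E d => outerSubOne y := continuous_outerSubOne
  have hn2 : ∫ ω, ‖Z ω‖ ^ 2 ∂P ≤ w * (16 * κ ^ 4 * d ^ 2) := by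
    have e : ∀ ω, ‖Z ω‖ ^ 2 = A.indicator (fun ω => ‖outerSubOne (Y ω)‖ ^ 2) ω := fun ω => by
      by_cases hω : ω ∈ A <;> simp [hZ, hω]
    simp only [e]
    rw [h.integral_indicator (g := fun y => ‖outerSubOne y‖ ^ 2)
      (hco.norm.pow 2).aestronglyMeasurable]
    exact mul_le_mul_of_nonneg_left hν.integral_norm_outerSubOne_sq_le hw.le
  have hn4 : ∫ ω, ‖Z ω‖ ^ 4 ∂P ≤ w * (2 * (4096 * κ ^ 8 * d ^ 4 + d ^ 2)) := by
    have e : ∀ ω, ‖Z ω‖ ^ 4 = A.indicator (fun ω => ‖outerSubOne (Y ω)‖ ^ 4) ω := fun ω => by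
      by_cases hω : ω ∈ A <;> simp [hZ, hω]
    simp only [e]
    rw [h.integral_indicator (g := fun y => ‖outerSubOne y‖ ^ 4)
      (hco.norm.pow 4).aestronglyMeasurable]
    exact mul_le_mul_of_nonneg_left hν.integral_norm_outerSubOne_pow_four_le hw.le
  -- Each of the two independent copies contributes a factor w through its indicator, so the main
  -- variance term scales as (nw)².
  have hB : ∫ x, ∫ y, (inner ℝ (Z y) (Z x) : ℝ) ^ 2 ∂P ∂P ≤ w * (w * (16 * Q ^ 2 * d ^ 2)) := by
    have e1 : ∀ x, ∫ y, (inner ℝ (Z y) (Z x) : ℝ) ^ 2 ∂P =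
        A.indicator (fun ω => w * ∫ y, (inner ℝ (outerSubOne y) (outerSubOne (Y ω)) : ℝ) ^ 2 ∂ν) x := by
      intro x
      have e : ∀ ω, (inner ℝ (Z ω) (Z x) : ℝ) ^ 2 =
          A.indicator (fun ω => (inner ℝ (outerSubOne (Y ω)) (Z x) : ℝ) ^ 2) ω := fun ω => by
        by_cases hω : ω ∈ A <;> simp [hZ, hω]
      simp only [e]
      rw [h.integral_indicator (g := fun y => (inner ℝ (outerSubOne y) (Z x) : ℝ) ^ 2)
        ((hco.inner continuous_const).pow 2).aestronglyMeasurable]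
      by_cases hx : x ∈ A <;> simp [hZ, hx]
    simp only [e1]
    have hcont : AEStronglyMeasurable (fun x : E d =>
        w * ∫ y, (inner ℝ (outerSubOne y) (outerSubOne x) : ℝ) ^ 2 ∂ν) ν := by
      refine AEStronglyMeasurable.const_mul ?_ w
      refine AEStronglyMeasurable.integral_prod_right' (f := fun p : E d × E d =>
        (inner ℝ (outerSubOne p.2) (outerSubOne p.1) : ℝ) ^ 2) ?_
      exact (((hco.comp continuous_snd).inner (hco.comp continuous_fst)).pow 2).aestronglyMeasurable
    rw [h.integral_indicator (g := fun x : E d =>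
        w * ∫ y, (inner ℝ (outerSubOne y) (outerSubOne x) : ℝ) ^ 2 ∂ν) hcont, integral_const_mul]
    exact mul_le_mul_of_nonneg_left (mul_le_mul_of_nonneg_left
      (hν.integral_inner_outerSubOne_sq_le hQ1 hQ) hw.le) hw.le
  have hmain := integral_norm_sum_sq_sub_sq_le hZ4 hZ0 n
  set τ := ∫ ω, ‖Z ω‖ ^ 2 ∂P
  have hτ : n * τ ≤ (n * w) ^ 2 := by
    calc n * τ ≤ n * (w * (16 * κ ^ 4 * d ^ 2)) := mul_le_mul_of_nonneg_left hn2 (by positivity)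
      _ = (n * w) * (16 * κ ^ 4 * d ^ 2) := by ring
      _ ≤ (n * w) * (n * w) := mul_le_mul_of_nonneg_left hκ hm.le
      _ = _ := by ring
  have hV : MemLp (fun ω : Fin n → Ω => ‖∑ i, Z (ω i)‖ ^ 2 - n * τ) 2 (Measure.pi fun _ => P) :=
    (memLp_norm_sq (memLp_sum_pi hZ4 n)).sub (memLp_const _)
  have h1 := mul_meas_ge_le_integral_of_nonneg (μ := Measure.pi fun _ : Fin n => P)
    (f := fun ω => (‖∑ i, Z (ω i)‖ ^ 2 - n * τ) ^ 2) (Eventually.of_forall fun ω => sq_nonneg _)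
    hV.integrable_sq ((3 * (n * w) ^ 2) ^ 2)
  have hsub : (Measure.pi fun _ : Fin n => P).real
        {ω | 2 * (n * w) ≤ ‖∑ i ∈ C ω, outerSubOne (Y (ω i))‖} ≤
      (Measure.pi fun _ : Fin n => P).real
        {ω | (3 * (n * w) ^ 2) ^ 2 ≤ (‖∑ i, Z (ω i)‖ ^ 2 - n * τ) ^ 2} := by
    refine measureReal_mono fun ω hω => ?_
    simp only [Set.mem_ofPred_eq] at hω ⊢
    rw [hZ, sum_indicator (hC ω)]
    have h2 := pow_le_pow_left₀ (by positivity) hω 2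
    refine pow_le_pow_left₀ (by positivity) ?_ 2
    nlinarith
  calc 9 * (n * w) ^ 4 * _ = (3 * (n * w) ^ 2) ^ 2 * (Measure.pi fun _ : Fin n => P).real
        {ω | 2 * (n * w) ≤ ‖∑ i ∈ C ω, outerSubOne (Y (ω i))‖} := by ring
    _ ≤ _ := mul_le_mul_of_nonneg_left hsub (by positivity)
    _ ≤ _ := h1.trans hmain
    _ ≤ 4 * n ^ 2 * (w * (w * (16 * Q ^ 2 * d ^ 2))) +
        2 * n * (w * (2 * (4096 * κ ^ 8 * d ^ 4 + d ^ 2))) := by gcongr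
    _ = _ := by ring

end HasLawOn

/-! ### Slabs and a finite grid of them. -/

/-- The slab of half-width `r` around the hyperplane `⟪b, y⟫ = a`. -/
def slab {d : ℕ} (b : E d) (a r : ℝ) : Set (E d) := {y | |inner ℝ b y - a| ≤ r}

lemma measurableSet_slab {d : ℕ} (b : E d) (a r : ℝ) : MeasurableSet (slab b a r) :=
  measurableSet_le (by fun_prop) measurable_const

/-- The vector with coordinates `z j / N`. -/
noncomputable def gridVec {d : ℕ} (N : ℕ) (z : Fin d → ℤ) : E d := WithLp.toLp 2 fun j => (z j : ℝ) / N

/-- Integer parameters of the slabs used to approximate all slabs. -/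
noncomputable def slabGrid (d : ℕ) (M : ℤ) : Finset ((Fin d → ℤ) × ℤ) :=
  (Fintype.piFinset fun _ => Finset.Icc (-M) M) ×ˢ Finset.Icc (-M) M

lemma card_slabGrid (d M : ℕ) : (slabGrid d M).card = (2 * M + 1) ^ (d + 1) := by
  have : ((M : ℤ) + 1 + M).toNat = 2 * M + 1 := by omega
  simp [slabGrid, Int.card_Icc, this, pow_succ]

lemma card_far_mul_sq_le {ι : Type*} (T : Finset ι) (u : ι → ℝ) (a r : ℝ) (hr : 0 ≤ r) :
    ((T.filter fun i => r < |u i - a|).card : ℝ) * r ^ 2 ≤ ∑ i ∈ T, (u i - a) ^ 2 := by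
  calc ((T.filter fun i => r < |u i - a|).card : ℝ) * r ^ 2
      = ∑ i ∈ T.filter (fun i => r < |u i - a|), r ^ 2 := by simp
    _ ≤ ∑ i ∈ T.filter (fun i => r < |u i - a|), (u i - a) ^ 2 := by
        refine Finset.sum_le_sum fun i hi => ?_
        rw [← sq_abs (u i - a)]
        exact pow_le_pow_left₀ hr (Finset.mem_filter.1 hi).2.le 2
    _ ≤ _ := Finset.sum_le_sum_of_subset_of_nonneg (Finset.filter_subset _ _)
        fun i _ _ => sq_nonneg _

lemma floor_mul_div_mem {N R : ℕ} (hN : 0 < N) {a : ℝ} (ha : |a| ≤ R) :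
    ⌊a * N⌋ ∈ Finset.Icc (-((N * R : ℕ) : ℤ)) ((N * R : ℕ) : ℤ) ∧
      |a - (⌊a * N⌋ : ℝ) / N| ≤ 1 / N := by
  have hN' : (0 : ℝ) < N := by exact_mod_cast hN
  obtain ⟨h1, h2⟩ := abs_le.1 ha
  refine ⟨Finset.mem_Icc.2 ⟨Int.le_floor.2 ?_, ?_⟩, ?_⟩
  · push_cast; nlinarith
  · have : ((⌊a * N⌋ : ℤ) : ℝ) ≤ ((N * R : ℕ) : ℤ) :=
      (Int.floor_le _).trans (by push_cast; nlinarith)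
    exact_mod_cast this
  · have h3 := Int.floor_le (a * N)
    have h4 := Int.lt_floor_add_one (a * N)
    have e : a - (⌊a * N⌋ : ℝ) / N = (a * N - ⌊a * N⌋) / N := by field_simp
    rw [e, abs_div, abs_of_nonneg (by linarith), abs_of_pos hN']
    gcongr; linarith

/-- A set of points with small variance in a direction mostly lies in a slab from the grid. -/
lemma exists_slabGrid {d : ℕ} {ι : Type*} {T : Finset ι} {y : ι → E d} {b : E d} {N R : ℕ}
    {s : ℝ} (hT : T.Nonempty) (hb : ‖b‖ = 1) (hN : 0 < N) (hR1 : 1 ≤ R)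
    (hR : ∀ i ∈ T, ‖y i‖ ≤ R) (hs : 0 < s) (hN2 : ((d : ℝ) * R + 1) / N ≤ s / 10)
    (hstd : dirStd y T b ≤ s) :
    ∃ p ∈ slabGrid d (N * R : ℕ), 1 - (d : ℝ) / N ≤ ‖gridVec N p.1‖ ∧
      3 / 4 * (T.card : ℝ) ≤
        (T.filter fun i => |inner ℝ (gridVec N p.1) (y i) - (p.2 : ℝ) / N| ≤ 21 / 10 * s).card := by
  have hN' : (0 : ℝ) < N := by exact_mod_cast hN
  have hTc : (0 : ℝ) < T.card := by exact_mod_cast hT.card_pos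
  set a : ℝ := inner ℝ b (mean y T) with ha
  have hmean : ‖mean y T‖ ≤ R := by
    rw [mean, norm_smul, norm_inv, Real.norm_of_nonneg hTc.le, inv_mul_le_iff₀ hTc]
    exact (norm_sum_le_of_le _ hR).trans_eq (by simp)
  have haR : |a| ≤ R := (abs_real_inner_le_norm _ _).trans (by rw [hb, one_mul]; exact hmean)
  have hbj : ∀ j, |b j| ≤ R := fun j => by
    have := PiLp.norm_apply_le b j
    rw [hb, Real.norm_eq_abs] at this
    exact this.trans (by exact_mod_cast hR1)
  set b' : E d := gridVec N fun j => ⌊b j * N⌋ with hb'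
  have hdist : ‖b - b'‖ ≤ d / N := by
    have h1 : ∀ j, |(b - b') j| ≤ 1 / N := fun j => by
      simpa [hb', gridVec] using (floor_mul_div_mem hN (hbj j)).2
    have h2 : ‖b - b'‖ ^ 2 ≤ d * (1 / N : ℝ) ^ 2 := by
      rw [EuclideanSpace.real_norm_sq_eq]
      calc ∑ j, (b - b') j ^ 2 ≤ ∑ _j : Fin d, (1 / N : ℝ) ^ 2 :=
            Finset.sum_le_sum fun j _ => by
              rw [← sq_abs]; exact pow_le_pow_left₀ (abs_nonneg _) (h1 j) 2
        _ = _ := by simp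
    refine le_of_sq_le_sq (h2.trans ?_) (by positivity)
    have : (d : ℝ) ≤ d ^ 2 := by exact_mod_cast Nat.le_self_pow (by norm_num) d
    calc (d : ℝ) * (1 / N) ^ 2 ≤ d ^ 2 * (1 / N) ^ 2 := by gcongr
      _ = _ := by ring
  refine ⟨(fun j => ⌊b j * N⌋, ⌊a * N⌋), ?_, ?_, ?_⟩
  · simp only [slabGrid, Finset.mem_product, Fintype.mem_piFinset]
    exact ⟨fun j => (floor_mul_div_mem hN (hbj j)).1, (floor_mul_div_mem hN haR).1⟩
  · have := norm_sub_norm_le b b'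
    rw [hb] at this
    show 1 - (d : ℝ) / N ≤ ‖b'‖
    linarith
  · have hfar := card_far_mul_sq_le T (fun i => inner ℝ b (y i)) a (2 * s) (by positivity)
    have hsum : ∑ i ∈ T, ((inner ℝ b (y i) : ℝ) - a) ^ 2 ≤ T.card * s ^ 2 := by
      have h1 := Real.sqrt_le_iff.1 hstd
      simp only [inner_sub_right, ← ha] at h1
      have h2 := h1.2
      rwa [inv_mul_le_iff₀ hTc] at h2
    have hfar2 : 4 * ((T.filter fun i => 2 * s < |(inner ℝ b (y i) : ℝ) - a|).card : ℝ) ≤ T.card := by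
      have := hfar.trans hsum
      have hs2 : 0 < s ^ 2 := by positivity
      refine le_of_mul_le_mul_right (a := s ^ 2) ?_ hs2
      linarith
    have hsplit := T.card_filter_add_card_filter_not (fun i => 2 * s < |(inner ℝ b (y i) : ℝ) - a|)
    have hsplit' : ((T.filter fun i => 2 * s < |(inner ℝ b (y i) : ℝ) - a|).card : ℝ) +
      (T.filter fun i => ¬ 2 * s < |(inner ℝ b (y i) : ℝ) - a|).card = T.card := by
      exact_mod_cast hsplit
    have hsub : (T.filter fun i => ¬ 2 * s < |(inner ℝ b (y i) : ℝ) - a|).card ≤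
        (T.filter fun i => |inner ℝ b' (y i) - ((⌊a * N⌋ : ℤ) : ℝ) / N| ≤ 21 / 10 * s).card := by
      refine Finset.card_le_card fun i hi => ?_
      obtain ⟨hiT, hi⟩ := Finset.mem_filter.1 hi
      refine Finset.mem_filter.2 ⟨hiT, ?_⟩
      -- Rounding b costs at most dR/N on points of norm at most R and rounding a costs 1/N,
      -- together at most s/10. The half-width grows from 2s to 2.1s.
      have e : (inner ℝ b' (y i) : ℝ) - ((⌊a * N⌋ : ℤ) : ℝ) / N = ((inner ℝ b (y i) : ℝ) - a)
          - inner ℝ (b - b') (y i) + (a - ((⌊a * N⌋ : ℤ) : ℝ) / N) := by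
        rw [inner_sub_left]; ring
      have h1 : |(inner ℝ (b - b') (y i) : ℝ)| ≤ d / N * R :=
        (abs_real_inner_le_norm _ _).trans (by gcongr; exact hR i hiT)
      have h2 := (floor_mul_div_mem hN haR).2
      have h3 : (d : ℝ) / N * R + 1 / N = ((d : ℝ) * R + 1) / N := by ring
      rw [e]
      have h4 := abs_add_le (((inner ℝ b (y i) : ℝ) - a) - inner ℝ (b - b') (y i))
        (a - ((⌊a * N⌋ : ℤ) : ℝ) / N)
      have h5 := abs_sub ((inner ℝ b (y i) : ℝ) - a) (inner ℝ (b - b') (y i))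
      linarith [not_lt.1 hi]
    have hsub' : ((T.filter fun i => ¬ 2 * s < |(inner ℝ b (y i) : ℝ) - a|).card : ℝ) ≤
        (T.filter fun i => |inner ℝ b' (y i) - ((⌊a * N⌋ : ℤ) : ℝ) / N| ≤ 21 / 10 * s).card := by
      exact_mod_cast hsub
    linarith

/-- Slabs have measure at most four times their width, relative to the length of the normal. -/
def SlabBound {d : ℕ} (ν : Measure (E d)) : Prop :=
  ∀ (b : E d) (a r : ℝ), b ≠ 0 → 0 ≤ r → ν.real (slab b a r) ≤ 8 * r / ‖b‖

/-- The sizes number at most n² and the slabs at most n^(12d), while √n ≥ 8900d makes the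
exponential at most n^(-16d). What remains is n^(2 - 4d) ≤ n^(-2). -/
lemma grid_union_bound {n d : ℕ} (hn : 3 ≤ n) (hd : 1 ≤ d) (hnd : 80000000 * (d : ℝ) ^ 2 ≤ n) :
    ((n : ℝ) + 1) * ((2 * (n : ℝ) ^ 5 + 1) ^ (d + 1) *
      Real.exp (-(18 / 100) * (Real.sqrt n * Real.log n / 100))) ≤ 1 / (n : ℝ) ^ 2 := by
  have hn' : (3 : ℝ) ≤ n := by exact_mod_cast hn
  have hd' : (1 : ℝ) ≤ d := by exact_mod_cast hd
  have hn0 : (0 : ℝ) < n := by linarith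
  have hlog : 0 ≤ Real.log n := Real.log_nonneg (by linarith)
  have hsq : 8900 * (d : ℝ) ≤ Real.sqrt n := by
    refine Real.le_sqrt_of_sq_le ?_
    nlinarith
  have h1 : Real.exp (-(18 / 100) * (Real.sqrt n * Real.log n / 100)) ≤ ((n : ℝ) ^ (16 * d))⁻¹ := by
    have : ((n : ℝ) ^ (16 * d))⁻¹ = Real.exp (-(16 * d * Real.log n)) := by
      rw [Real.exp_neg, ← Real.exp_log (pow_pos hn0 (16 * d)), Real.log_pow]; push_cast; rfl
    rw [this, Real.exp_le_exp]
    nlinarith [mul_le_mul_of_nonneg_right hsq hlog, mul_nonneg (by linarith : (0 : ℝ) ≤ d) hlog]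
  have h2 : (2 * (n : ℝ) ^ 5 + 1) ^ (d + 1) ≤ (n : ℝ) ^ (12 * d) := by
    have h3 : 2 * (n : ℝ) ^ 5 + 1 ≤ (n : ℝ) ^ 6 := by
      have : (1 : ℝ) ≤ (n : ℝ) ^ 5 := one_le_pow₀ (by linarith)
      rw [pow_succ (n : ℝ) 5]; nlinarith
    calc (2 * (n : ℝ) ^ 5 + 1) ^ (d + 1) ≤ ((n : ℝ) ^ 6) ^ (d + 1) := by gcongr
      _ = (n : ℝ) ^ (6 * (d + 1)) := by rw [← pow_mul]
      _ ≤ _ := pow_le_pow_right₀ (by linarith) (by omega)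
  have h3 : (n : ℝ) + 1 ≤ (n : ℝ) ^ 2 := by nlinarith
  calc _ ≤ (n : ℝ) ^ 2 * ((n : ℝ) ^ (12 * d) * ((n : ℝ) ^ (16 * d))⁻¹) := by gcongr
    _ = (n : ℝ) ^ (12 * d + 2) / (n : ℝ) ^ (16 * d) := by rw [pow_add]; ring
    _ ≤ 1 / (n : ℝ) ^ 2 := by
        rw [div_le_div_iff₀ (by positivity) (by positivity), ← pow_add, one_mul]
        exact pow_le_pow_right₀ (by linarith) (by omega)

/-- With `n` samples, some grid slab contains far more points than expected. -/
def CrowdedSlab {Ω : Type*} {d n : ℕ} (A : Set Ω) (Y : Ω → E d) (w : ℝ) (ω : Fin n → Ω) : Prop :=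
  ∃ t ∈ (Finset.range (n + 1)).filter fun t : ℕ => Real.sqrt n * Real.log n / 100 ≤ t,
    ∃ p ∈ (slabGrid d (n ^ 5 : ℕ)).filter fun p => 9 / 10 ≤ ‖gridVec (n ^ 4) p.1‖,
      3 / 4 * (t : ℝ) ≤ ∑ i, (A ∩ Y ⁻¹' slab (gridVec (n ^ 4) p.1) ((p.2 : ℝ) / (n ^ 4 : ℕ))
        (14 / 375 * (t / (n * w)))).indicator (fun _ => (1 : ℝ)) (ω i)

lemma HasLawOn.real_crowdedSlab_le {Ω : Type*} [MeasurableSpace Ω] {d n : ℕ} {P : Measure Ω}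
    [IsProbabilityMeasure P] {A : Set Ω} {Y : Ω → E d} {w : ℝ} {ν : Measure (E d)}
    (h : HasLawOn P A Y w ν) (hac : SlabBound ν) (hn : 3 ≤ n) (hd : 1 ≤ d)
    (hnd : 80000000 * (d : ℝ) ^ 2 ≤ n) :
    (Measure.pi fun _ : Fin n => P).real {ω | CrowdedSlab A Y w ω} ≤ 1 / (n : ℝ) ^ 2 := by
  have hw := h.pos
  have hn0 : (0 : ℝ) < n := by exact_mod_cast (by omega : 0 < n)
  set t₀ : ℝ := Real.sqrt n * Real.log n / 100
  set 𝒯 := (Finset.range (n + 1)).filter fun t : ℕ => t₀ ≤ t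
  set 𝒢 := (slabGrid d (n ^ 5 : ℕ)).filter fun p => 9 / 10 ≤ ‖gridVec (n ^ 4) p.1‖
  have hone : ∀ t ∈ 𝒯, ∀ p ∈ 𝒢, (Measure.pi fun _ : Fin n => P).real {ω | 3 / 4 * (t : ℝ) ≤
      ∑ i, (A ∩ Y ⁻¹' slab (gridVec (n ^ 4) p.1) ((p.2 : ℝ) / (n ^ 4 : ℕ))
        (14 / 375 * (t / (n * w)))).indicator (fun _ => (1 : ℝ)) (ω i)}
      ≤ Real.exp (-(18 / 100) * t₀) := by
    intro t ht p hp
    have ht0 : t₀ ≤ t := (Finset.mem_filter.1 ht).2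
    have hp9 : (9 : ℝ) / 10 ≤ ‖gridVec (n ^ 4) p.1‖ := (Finset.mem_filter.1 hp).2
    have hne : gridVec (n ^ 4) p.1 ≠ 0 := fun h0 => by rw [h0, norm_zero] at hp9; norm_num at hp9
    set r : ℝ := 14 / 375 * (t / (n * w)) with hr
    have hr0 : 0 ≤ r := by positivity
    have hq : P.real (A ∩ Y ⁻¹' slab (gridVec (n ^ 4) p.1) ((p.2 : ℝ) / (n ^ 4 : ℕ)) r)
        ≤ 332 / 1000 * t / n := by
      rw [h.real_inter_preimage (measurableSet_slab _ _ _)]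
      -- The normal has length at least 9/10, and 8 · (14/375) · (10/9) < 0.332.
      calc w * ν.real (slab (gridVec (n ^ 4) p.1) ((p.2 : ℝ) / (n ^ 4 : ℕ)) r)
          ≤ w * (8 * r / ‖gridVec (n ^ 4) p.1‖) := by gcongr; exact hac _ _ _ hne hr0
        _ ≤ w * (8 * r / (9 / 10)) := by gcongr
        _ = (8 * 14 / 375 * 10 / 9) * t / n := by rw [hr]; field_simp
        _ ≤ _ := div_le_div_of_nonneg_right
            (mul_le_mul_of_nonneg_right (by norm_num) (by positivity)) hn0.le
    refine (real_count_le P (h.measurableSet.inter (h.measurable (measurableSet_slab _ _ _))) n _ _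
      hq).trans (Real.exp_le_exp.2 ?_)
    have e : (n : ℝ) * (332 / 1000 * t / n) = 332 / 1000 * t := by field_simp
    rw [e]
    -- 0.332 - (3/4) log 2 < -0.18, and t ≥ t₀.
    have hl := Real.log_two_gt_d9
    have ht1 : (0 : ℝ) ≤ t := by positivity
    nlinarith
  have hsub : {ω : Fin n → Ω | CrowdedSlab A Y w ω} ⊆ ⋃ t ∈ 𝒯, ⋃ p ∈ 𝒢, {ω | 3 / 4 * (t : ℝ) ≤
      ∑ i, (A ∩ Y ⁻¹' slab (gridVec (n ^ 4) p.1) ((p.2 : ℝ) / (n ^ 4 : ℕ))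
        (14 / 375 * (t / (n * w)))).indicator (fun _ => (1 : ℝ)) (ω i)} := by
    rintro ω ⟨t, ht, p, hp, h1⟩
    simp only [Set.mem_iUnion]
    exact ⟨t, ht, p, hp, h1⟩
  have h𝒯c : (𝒯.card : ℝ) ≤ (n : ℝ) + 1 := by
    have := Finset.card_filter_le (Finset.range (n + 1)) fun t : ℕ => t₀ ≤ t
    rw [Finset.card_range] at this
    exact_mod_cast this
  have h𝒢c : (𝒢.card : ℝ) ≤ (2 * (n : ℝ) ^ 5 + 1) ^ (d + 1) := by
    have := Finset.card_filter_le (slabGrid d (n ^ 5 : ℕ)) fun p => 9 / 10 ≤ ‖gridVec (n ^ 4) p.1‖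
    rw [card_slabGrid] at this
    exact_mod_cast this
  calc _ ≤ _ := measureReal_mono hsub (measure_ne_top _ _)
    _ ≤ ∑ t ∈ 𝒯, ∑ p ∈ 𝒢, Real.exp (-(18 / 100) * t₀) :=
        (measureReal_biUnion_finset_le _ _).trans (Finset.sum_le_sum fun t ht =>
          (measureReal_biUnion_finset_le _ _).trans (Finset.sum_le_sum fun p hp => hone t ht p hp))
    _ = 𝒯.card * (𝒢.card * Real.exp (-(18 / 100) * t₀)) := by simp
    _ ≤ ((n : ℝ) + 1) * ((2 * (n : ℝ) ^ 5 + 1) ^ (d + 1) * Real.exp (-(18 / 100) * t₀)) := by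
        gcongr
    _ ≤ _ := grid_union_bound hn hd hnd

/-! ### The two good events for a whitened cluster. -/

/-- The whitened cluster has small mean and bounded second moments. -/
structure GoodMoments {d : ℕ} {ι : Type*} (y : ι → E d) (C : Finset ι) : Prop where
  nonempty : C.Nonempty
  mean_le : ‖mean y C‖ ≤ 2
  second_le : ∀ b : E d, ∑ i ∈ C, (inner ℝ b (y i) : ℝ) ^ 2 ≤ 4 * C.card * ‖b‖ ^ 2

/-- The whitened cluster has no tight sub-cluster. -/
def Spread {d n : ℕ} (y : Fin n → E d) (C : Finset (Fin n)) : Prop :=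
  ∀ T ⊆ C, Real.sqrt n * Real.log n / 100 ≤ (T.card : ℝ) → ∀ b : E d, ‖b‖ = 1 →
    2 * (T.card : ℝ) / (125 * C.card) ≤ dirStd y T b

/-- Testing the second-moment bound in the direction of the point itself gives ‖y‖⁴ ≤ 4|C|‖y‖². This
confines the points to a polynomial ball without a separate tail estimate. -/
lemma GoodMoments.norm_le {d : ℕ} {ι : Type*} {y : ι → E d} {C : Finset ι} (h : GoodMoments y C)
    {i : ι} (hi : i ∈ C) : ‖y i‖ ^ 2 ≤ 4 * C.card := by
  rcases eq_or_ne (y i) 0 with h0 | h0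
  · rw [h0]; simp
  have h1 := (Finset.single_le_sum (f := fun j => (inner ℝ (y i) (y j) : ℝ) ^ 2)
    (fun j _ => sq_nonneg _) hi).trans (h.second_le (y i))
  rw [real_inner_self_eq_norm_sq] at h1
  have h2 : 0 < ‖y i‖ ^ 2 := by positivity
  refine le_of_mul_le_mul_right (a := ‖y i‖ ^ 2) ?_ h2
  linarith

/-- With s = √m one has d ≤ s, κ² ≤ s/7 and κ⁴d² ≤ m/50. So κ⁶d² = κ² · κ⁴d² is O(s³), and division
by m² = s⁴ leaves O(1/s). The term with κ⁸d⁴ is of order 1/m. -/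
lemma moment_arith {m p κ Q d : ℝ} (hd : 1 ≤ d) (hκ1 : 1 ≤ 16 * κ ^ 4)
    (hm : 50 * κ ^ 4 * d ^ 2 ≤ m) (hQ : Q ^ 2 = 216 * κ ^ 6)
    (hp : 9 * m ^ 4 * p ≤ 64 * m ^ 2 * (Q ^ 2 * d ^ 2)
      + 4 * m * (4096 * κ ^ 8 * d ^ 4 + d ^ 2)) :
    100 / m + d / m + p ≤ 110 / Real.sqrt m := by
  have hd2 : 1 ≤ d ^ 2 := by nlinarith
  set X := κ ^ 4 * d ^ 2 with hX
  have hXd : d ^ 2 ≤ 16 * X := by nlinarith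
  have hXm : 50 * X ≤ m := by linarith
  have hX0 : 0 < X := by nlinarith
  have hm1 : 1 ≤ m := by linarith
  have hm0 : 0 < m := by linarith
  obtain ⟨s, hs⟩ : ∃ s, s = Real.sqrt m := ⟨_, rfl⟩
  have hs2 : s ^ 2 = m := by rw [hs]; exact Real.sq_sqrt hm0.le
  have hs1 : 1 ≤ s := by rw [hs]; exact Real.one_le_sqrt.2 hm1
  rw [← hs]
  have hs0 : 0 < s := by linarith
  have h1 : 100 / m ≤ 100 / s := by
    gcongr; nlinarith
  have hds : d ≤ s := by
    refine le_of_sq_le_sq ?_ hs0.le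
    linarith
  have h2 : d / m ≤ 1 / s := by
    rw [div_le_div_iff₀ hm0 hs0]; nlinarith
  have ha : κ ^ 2 ≤ s / 7 := by
    refine le_of_sq_le_sq ?_ (by positivity)
    have : (κ ^ 2) ^ 2 ≤ X := by
      calc (κ ^ 2) ^ 2 = κ ^ 4 * 1 := by ring
        _ ≤ X := by rw [hX]; gcongr
    rw [div_pow, hs2]; linarith
  have h6 : κ ^ 6 * d ^ 2 ≤ s ^ 3 / 350 := by
    calc κ ^ 6 * d ^ 2 = κ ^ 2 * X := by rw [hX]; ring
      _ ≤ s / 7 * (s ^ 2 / 50) := by gcongr; linarith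
      _ = _ := by ring
  have h8 : κ ^ 8 * d ^ 4 ≤ m ^ 2 / 2500 := by
    calc κ ^ 8 * d ^ 4 = X ^ 2 := by rw [hX]; ring
      _ ≤ (m / 50) ^ 2 := by gcongr; linarith
      _ = _ := by ring
  have h3 : p ≤ 6 / s := by
    have hr : 9 * s ^ 8 * p ≤ 9 * s ^ 8 * (6 / s) := by
      have e1 : 9 * s ^ 8 * (6 / s) = 54 * s ^ 7 := by field_simp; ring
      have e2 : 9 * m ^ 4 * p = 9 * s ^ 8 * p := by rw [← hs2]; ring
      rw [e1, ← e2]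
      refine hp.trans ?_
      have b1 : 64 * m ^ 2 * (Q ^ 2 * d ^ 2) ≤ 40 * s ^ 7 := by
        rw [hQ, ← hs2]
        have : 64 * (s ^ 2) ^ 2 * (216 * κ ^ 6 * d ^ 2) = 13824 * s ^ 4 * (κ ^ 6 * d ^ 2) := by ring
        rw [this]
        calc _ ≤ 13824 * s ^ 4 * (s ^ 3 / 350) := by gcongr
          _ = 13824 / 350 * s ^ 7 := by ring
          _ ≤ _ := by gcongr; norm_num
      have b2 : 4 * m * (4096 * κ ^ 8 * d ^ 4 + d ^ 2) ≤ 12 * s ^ 6 := by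
        have : 4096 * κ ^ 8 * d ^ 4 + d ^ 2 ≤ 3 * m ^ 2 := by nlinarith
        calc _ ≤ 4 * m * (3 * m ^ 2) := by gcongr
          _ = _ := by rw [← hs2]; ring
      have b3 : s ^ 6 ≤ s ^ 7 := pow_le_pow_right₀ hs1 (by norm_num)
      linarith [pow_pos hs0 7]
    exact le_of_mul_le_mul_left hr (by positivity)
  calc _ ≤ 100 / s + 1 / s + 6 / s := by linarith
    _ = 107 / s := by ring
    _ ≤ _ := by gcongr; norm_num

lemma HasLawOn.real_not_goodMoments_le {Ω : Type*} [MeasurableSpace Ω] {d n : ℕ} {P : Measure Ω}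
    [IsProbabilityMeasure P] {A : Set Ω} {Y : Ω → E d} {w κ : ℝ} {ν : Measure (E d)}
    [IsProbabilityMeasure ν] (h : HasLawOn P A Y w ν) (hν : IsWhite κ ν) (hn : 0 < n) (hd : 1 ≤ d)
    (hκ : 50 * κ ^ 4 * d ^ 2 ≤ n * w) {C : (Fin n → Ω) → Finset (Fin n)}
    (hC : ∀ ω i, i ∈ C ω ↔ ω i ∈ A) :
    (Measure.pi fun _ : Fin n => P).real {ω | ¬ (9 / 10 * (n * w) ≤ (C ω).card ∧
      GoodMoments (fun i => Y (ω i)) (C ω))} ≤ 110 / Real.sqrt (n * w) := by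
  have hw := h.pos
  have hm : 0 < n * w := by positivity
  have hκ1 : 1 ≤ 16 * κ ^ 4 := hν.one_le_of_pow_four hd hν.fourth
  -- This Q, rather than 16κ⁴, makes the main variance term decay.
  set Q := Real.sqrt (216 * κ ^ 6) with hQdef
  have hκ6 : 0 ≤ 216 * κ ^ 6 := by positivity
  have hQ2 : Q ^ 2 = 216 * κ ^ 6 := Real.sq_sqrt hκ6
  have hQ : ∀ b : E d, ∫ y, (inner ℝ b y : ℝ) ^ 4 ∂ν ≤ Q * ‖b‖ ^ 4 := fun b => by
    refine le_of_sq_le_sq ((hν.integral_inner_pow_four_le_of_sq b).trans_eq ?_) (by positivity)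
    rw [mul_pow, hQ2]; ring
  have hQ1 : 1 ≤ Q := hν.one_le_of_pow_four hd hQ
  have hd' : (1 : ℝ) ≤ d := by exact_mod_cast hd
  have b3 := h.real_norm_sum_outer_le hν hn hC hQ1 hQ
    (by nlinarith [show 0 ≤ κ ^ 4 * (d : ℝ) ^ 2 by positivity])
  refine le_trans ?_ (moment_arith hd' hκ1 hκ hQ2 b3)
  refine le_trans ?_ (add_le_add (add_le_add (h.real_card_sub_le hn hC)
    (h.real_norm_sum_le hν hn hC)) le_rfl)
  refine le_trans (measureReal_mono ?_ (measure_ne_top _ _)) ((measureReal_union_le _ _).trans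
    (add_le_add (measureReal_union_le _ _) le_rfl))
  intro ω hω
  by_contra hnot
  simp only [Set.mem_union, Set.mem_ofPred_eq, not_or, not_le] at hnot
  obtain ⟨⟨h1, h2⟩, h3⟩ := hnot
  have hcard : 9 / 10 * (n * w) ≤ (C ω).card := by
    have := (abs_lt.1 h1).1; linarith
  have hc0 : (0 : ℝ) < (C ω).card := by linarith
  refine hω ⟨hcard, ⟨Finset.card_pos.1 (by exact_mod_cast hc0), ?_, fun b => ?_⟩⟩
  · rw [mean, norm_smul, norm_inv, Real.norm_of_nonneg hc0.le, inv_mul_le_iff₀ hc0]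
    linarith
  · have h4 := sum_inner_sq_sub_le (C ω) (fun i => Y (ω i)) b
    rw [Finset.sum_sub_distrib, Finset.sum_const, nsmul_eq_mul] at h4
    -- |C| ≥ 0.9nw turns 2nw into less than 3|C|; the remaining |C| of the bound 4|C| is the
    -- isotropic part.
    have h5 : ‖b‖ ^ 2 * ‖∑ i ∈ C ω, outerSubOne (Y (ω i))‖ ≤ ‖b‖ ^ 2 * (3 * (C ω).card) := by
      gcongr; linarith
    linarith

/-- By contraposition: a tight T would put three quarters of its points into one grid slab. -/
lemma spread_of_not_crowdedSlab {Ω : Type*} {d n : ℕ} {A : Set Ω} {Y : Ω → E d} {w : ℝ}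
    {ω : Fin n → Ω} {C : Finset (Fin n)} (hC : ∀ i, i ∈ C ↔ ω i ∈ A) (hn : 700 ≤ n)
    (hdn : d + 1 ≤ n) (hw : 0 < w) (hw1 : w ≤ 1) (hcard : 9 / 10 * (n * w) ≤ C.card)
    (hg : GoodMoments (fun i => Y (ω i)) C) (hcr : ¬ CrowdedSlab A Y w ω) :
    Spread (fun i => Y (ω i)) C := by
  intro T hT ht0 b hb
  by_contra! hlt
  refine hcr ?_
  have hn' : (700 : ℝ) ≤ n := by exact_mod_cast hn
  have hn0 : (0 : ℝ) < n := by linarith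
  have hm : 0 < n * w := by positivity
  have htpos : (0 : ℝ) < T.card := lt_of_lt_of_le (by
    have : 0 < Real.log n := Real.log_pos (by linarith)
    positivity) ht0
  have htne : T.Nonempty := Finset.card_pos.1 (by exact_mod_cast htpos)
  have ht1 : (1 : ℝ) ≤ T.card := by exact_mod_cast htne.card_pos
  have hCn : C.card ≤ n := (Finset.card_le_univ C).trans_eq (Fintype.card_fin n)
  have hCn' : (C.card : ℝ) ≤ n := by exact_mod_cast hCn
  have hdn' : (d : ℝ) + 1 ≤ n := by exact_mod_cast hdn
  -- 4/225 = 2/(125 · 0.9): the forbidden deviation after replacing |C| by its lower bound 0.9nw.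
  set s : ℝ := 4 / 225 * (T.card / (n * w)) with hs
  have hs0 : 0 < s := by positivity
  have hstd : dirStd (fun i => Y (ω i)) T b ≤ s := by
    refine hlt.le.trans ?_
    calc 2 * (T.card : ℝ) / (125 * C.card) ≤ 2 * (T.card : ℝ) / (125 * (9 / 10 * (n * w))) := by
          gcongr
      _ = s := by rw [hs]; field_simp; norm_num
  have hR : ∀ i ∈ T, ‖Y (ω i)‖ ≤ n := fun i hi => by
    refine le_of_sq_le_sq ((hg.norm_le (hT hi)).trans ?_) hn0.le
    nlinarith
  have hsn : 4 / 225 * (1 / (n : ℝ)) ≤ s := by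
    rw [hs]; gcongr
    nlinarith
  have hN2 : ((d : ℝ) * n + 1) / (n ^ 4 : ℕ) ≤ s / 10 := by
    have h1 : ((d : ℝ) * n + 1) / (n ^ 4 : ℕ) ≤ (n : ℝ) ^ 2 / (n : ℝ) ^ 4 := by
      push_cast; gcongr; nlinarith
    have h2 : (n : ℝ) ^ 2 / (n : ℝ) ^ 4 = 1 / n * (1 / n) := by field_simp
    -- n ≥ 700 is used here: 1/n ≤ 4/2250.
    have h3 : 1 / (n : ℝ) * (1 / n) ≤ 1 / n * (4 / 2250) := by
      refine mul_le_mul_of_nonneg_left ?_ (by positivity)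
      rw [div_le_div_iff₀ hn0 (by norm_num)]; linarith
    rw [h2] at h1
    linarith
  obtain ⟨p, hp, hp9, hpc⟩ := exists_slabGrid htne hb (pow_pos (by omega : 0 < n) 4)
    (by omega : 1 ≤ n) hR hs0 hN2 hstd
  have hTn : T.card < n + 1 := Nat.lt_succ_of_le ((Finset.card_le_card hT).trans hCn)
  refine ⟨T.card, Finset.mem_filter.2 ⟨Finset.mem_range.2 hTn, ht0⟩, p, Finset.mem_filter.2
    ⟨by rwa [← pow_succ] at hp, ?_⟩, ?_⟩
  · refine le_trans ?_ hp9
    have : (d : ℝ) / (n ^ 4 : ℕ) ≤ 1 / 10 := by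
      rw [div_le_div_iff₀ (by positivity) (by norm_num)]
      push_cast
      have h1 : (n : ℝ) ≤ n ^ 3 := le_self_pow₀ (by linarith) (by norm_num)
      rw [pow_succ]
      nlinarith
    linarith
  · refine hpc.trans ?_
    -- 14/375 = (21/10)(4/225), the half-width after rounding.
    have e : 14 / 375 * ((T.card : ℝ) / (n * w)) = 21 / 10 * s := by rw [hs]; ring
    rw [e]
    set B := A ∩ Y ⁻¹' slab (gridVec (n ^ 4) p.1) ((p.2 : ℝ) / (n ^ 4 : ℕ)) (21 / 10 * s)
    have hsub : ∀ i ∈ T.filter (fun i => |inner ℝ (gridVec (n ^ 4) p.1) (Y (ω i)) -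
        (p.2 : ℝ) / (n ^ 4 : ℕ)| ≤ 21 / 10 * s), ω i ∈ B := fun i hi =>
      ⟨(hC i).1 (hT (Finset.mem_filter.1 hi).1), (Finset.mem_filter.1 hi).2⟩
    calc _ = ∑ i ∈ T.filter (fun i => |inner ℝ (gridVec (n ^ 4) p.1) (Y (ω i)) -
        (p.2 : ℝ) / (n ^ 4 : ℕ)| ≤ 21 / 10 * s), B.indicator (fun _ => (1 : ℝ)) (ω i) := by
          rw [Finset.sum_congr rfl fun i hi => Set.indicator_of_mem (hsub i hi) _]; simp
      _ ≤ _ := Finset.sum_le_sum_of_subset_of_nonneg (Finset.subset_univ _)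
          fun i _ _ => Set.indicator_nonneg (fun _ _ => zero_le_one) _

lemma HasLawOn.real_not_good_le {Ω : Type*} [MeasurableSpace Ω] {d n : ℕ} {P : Measure Ω}
    [IsProbabilityMeasure P] {A : Set Ω} {Y : Ω → E d} {w κ : ℝ} {ν : Measure (E d)}
    [IsProbabilityMeasure ν] (h : HasLawOn P A Y w ν) (hν : IsWhite κ ν) (hac : SlabBound ν)
    (hn : 700 ≤ n) (hd : 1 ≤ d) (hκ : 50 * κ ^ 4 * d ^ 2 ≤ n * w)
    (hnd : 80000000 * (d : ℝ) ^ 2 ≤ n) {C : (Fin n → Ω) → Finset (Fin n)}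
    (hC : ∀ ω i, i ∈ C ω ↔ ω i ∈ A) :
    (Measure.pi fun _ : Fin n => P).real {ω | ¬ (GoodMoments (fun i => Y (ω i)) (C ω) ∧
      Spread (fun i => Y (ω i)) (C ω))} ≤ 110 / Real.sqrt (n * w) + 1 / (n : ℝ) ^ 2 := by
  have hw1 : w ≤ 1 := by rw [← h.real_eq]; exact measureReal_le_one
  have hdn : d + 1 ≤ n := by
    have h1 : (1 : ℝ) ≤ d := by exact_mod_cast hd
    have : (d : ℝ) + 1 ≤ n := by nlinarith
    exact_mod_cast this
  refine le_trans (measureReal_mono ?_ (measure_ne_top _ _)) ((measureReal_union_le _ _).trans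
    (add_le_add (h.real_not_goodMoments_le hν (by omega) hd hκ hC)
      (h.real_crowdedSlab_le hac (by omega) hd hnd)))
  intro ω hω
  by_contra hnot
  simp only [Set.mem_union, Set.mem_ofPred_eq, not_or, not_not] at hnot
  obtain ⟨⟨h1, h2⟩, h3⟩ := hnot
  exact hω ⟨h2, spread_of_not_crowdedSlab (hC ω) hn hdn h.pos hw1 h1 h2 h3⟩

/-! ### Marginals of a sub-Gaussian density. -/

section

variable {d : ℕ} {f : E d → ℝ}

lemma IsPDF.isProbabilityMeasure (hf : IsPDF f) : IsProbabilityMeasure (law f) := by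
  refine ⟨?_⟩
  rw [law, withDensity_apply _ MeasurableSet.univ, Measure.restrict_univ, hf.total]

lemma law_absolutelyContinuous : law f ≪ volume := withDensity_absolutelyContinuous _ _

/-- The centred marginal of `x` in direction `v`. -/
noncomputable def centred (f : E d → ℝ) (v x : E d) : ℝ := inner ℝ v (x - pdfMean f)

lemma measurable_centred (v : E d) : Measurable (centred f v) := by
  unfold centred; fun_prop

lemma eLpNorm_centred_le {v : E d} (hv : ‖v‖ = 1) {p : ℝ} (hp : 1 ≤ p) :
    eLpNorm (centred f v) (ENNReal.ofReal p) (law f) ≤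
      ENNReal.ofReal (Real.sqrt p) * pdfSgNorm f := by
  have h1 : eLpNorm (centred f v) (ENNReal.ofReal p) (law f) / ENNReal.ofReal (Real.sqrt p)
      ≤ pdfSgNorm f := by
    unfold pdfSgNorm sgNorm
    exact (le_iSup₂ (f := fun (p : ℝ) (_ : 1 ≤ p) => eLpNorm (centred f v) (ENNReal.ofReal p) (law f)
      / ENNReal.ofReal (Real.sqrt p)) p hp).trans
      (le_iSup₂ (f := fun (v : E d) (_ : ‖v‖ = 1) => ⨆ (p : ℝ) (_ : 1 ≤ p),
        eLpNorm (centred f v) (ENNReal.ofReal p) (law f) / ENNReal.ofReal (Real.sqrt p)) v hv)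
  rw [mul_comm]
  exact (ENNReal.div_le_iff_le_mul (Or.inl (by
    simp only [ne_eq, ENNReal.ofReal_eq_zero, not_le]; positivity)) (Or.inl ENNReal.ofReal_ne_top)).1 h1

lemma memLp_centred_of_unit (hs : IsSubGaussian f) {v : E d} (hv : ‖v‖ = 1) :
    MemLp (centred f v) 8 (law f) := by
  refine ⟨(measurable_centred v).aestronglyMeasurable, ?_⟩
  have h := eLpNorm_centred_le (f := f) hv (p := 8) (by norm_num)
  rw [show ENNReal.ofReal 8 = 8 by norm_num] at h
  exact h.trans_lt (ENNReal.mul_lt_top ENNReal.ofReal_lt_top hs)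

lemma memLp_sub_pdfMean (hs : IsSubGaussian f) :
    MemLp (fun x : E d => x - pdfMean f) 8 (law f) := by
  refine MemLp.of_eval_piLp fun i => ?_
  have := memLp_centred_of_unit hs (v := EuclideanSpace.single i (1 : ℝ)) (by simp)
  unfold centred at this
  simpa [EuclideanSpace.inner_single_left] using this

lemma memLp_centred (hs : IsSubGaussian f) (v : E d) : MemLp (centred f v) 8 (law f) :=
  (memLp_sub_pdfMean hs).const_inner (𝕜 := ℝ) v

lemma integrable_law (hf : IsPDF f) (hs : IsSubGaussian f) :
    Integrable (fun x : E d => x) (law f) := by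
  have := hf.isProbabilityMeasure
  have h := ((memLp_sub_pdfMean hs).integrable (by norm_num)).add (integrable_const (pdfMean f))
  simpa [Pi.add_def] using h

lemma integral_inner_law (hf : IsPDF f) (hs : IsSubGaussian f) (v : E d) :
    ∫ x, (inner ℝ v x : ℝ) ∂law f = inner ℝ v (pdfMean f) :=
  integral_inner (integrable_law hf hs) v

lemma integral_centred (hf : IsPDF f) (hs : IsSubGaussian f) (v : E d) :
    ∫ x, centred f v x ∂law f = 0 := by
  have := hf.isProbabilityMeasure
  simp only [centred, inner_sub_right]
  rw [integral_sub ((integrable_law hf hs).const_inner v) (integrable_const _),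
    integral_inner_law hf hs]
  simp

lemma pdfDirStd_sq (hf : IsPDF f) (hs : IsSubGaussian f) (v : E d) :
    pdfDirStd f v ^ 2 = ∫ x, centred f v x ^ 2 ∂law f := by
  rw [pdfDirStd, Real.sq_sqrt (variance_nonneg _ _), variance_eq_integral (by fun_prop),
    integral_inner_law hf hs]
  simp [centred, inner_sub_right]

lemma integral_centred_pow_le (hs : IsSubGaussian f) {k : ℕ} (hk1 : 1 ≤ k)
    (hk8 : k ≤ 8) (hke : Even k) (hf : IsPDF f) (v : E d) :
    ∫ x, centred f v x ^ k ∂law f ≤ (Real.sqrt k * ((pdfSgNorm f).toReal * ‖v‖)) ^ k := by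
  have := hf.isProbabilityMeasure
  rcases eq_or_ne v 0 with rfl | hv
  · simp [centred]
  have hv0 : 0 < ‖v‖ := norm_pos_iff.2 hv
  set u : E d := ‖v‖⁻¹ • v with hu
  have hu1 : ‖u‖ = 1 := norm_smul_inv_norm (𝕜 := ℝ) hv
  have hk0 : (k : ℝ≥0∞) ≠ 0 := by exact_mod_cast (by omega : k ≠ 0)
  have hmem : MemLp (centred f u) k (law f) :=
    (memLp_centred hs u).mono_exponent (by exact_mod_cast hk8)
  have h1 := eLpNorm_centred_le (f := f) hu1 (p := k) (by exact_mod_cast hk1)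
  rw [ENNReal.ofReal_natCast, hmem.eLpNorm_eq_integral_rpow_norm hk0 (by simp)] at h1
  have hI : 0 ≤ ∫ x, centred f u x ^ k ∂law f := integral_nonneg fun x => hke.pow_nonneg _
  have e : ∫ x, ‖centred f u x‖ ^ (k : ℝ≥0∞).toReal ∂law f = ∫ x, centred f u x ^ k ∂law f := by
    refine integral_congr_ae (Eventually.of_forall fun x => ?_)
    simp [Real.rpow_natCast, hke.pow_abs]
  rw [e, ← ENNReal.ofReal_toReal (ne_of_lt hs), ← ENNReal.ofReal_mul (Real.sqrt_nonneg _),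
    ENNReal.ofReal_le_ofReal_iff (by positivity)] at h1
  have h2 := pow_le_pow_left₀ (by positivity) h1 k
  rw [ENNReal.toReal_natCast, Real.rpow_inv_natCast_pow hI (by omega)] at h2
  have e2 : ∀ x, centred f v x = ‖v‖ * centred f u x := fun x => by
    simp only [centred, hu, inner_smul_left]; simp; field_simp
  simp only [e2, mul_pow]
  rw [integral_const_mul]
  rw [mul_pow] at h2
  calc _ ≤ ‖v‖ ^ k * _ := mul_le_mul_of_nonneg_left h2 (by positivity)
    _ = _ := by ring

/-- A surjective linear map sends Lebesgue measure to a multiple, possibly infinite, of Lebesgue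
measure; absolute continuity survives either way. -/
lemma map_inner_absolutelyContinuous {v : E d} (hv : v ≠ 0) :
    (law f).map (fun x => (inner ℝ v x : ℝ)) ≪ volume := by
  have hm : Measurable fun x : E d => (inner ℝ v x : ℝ) := by fun_prop
  refine (law_absolutelyContinuous.map hm).trans ?_
  have hsurj : Function.Surjective (innerₛₗ ℝ v) := by
    refine LinearMap.surjective fun h0 => hv ?_
    have := LinearMap.congr_fun h0 v
    simpa using this
  obtain ⟨c, -, hc⟩ := (innerₛₗ ℝ v).exists_map_addHaar_eq_smul_addHaar
    (volume : Measure (E d)) (volume : Measure ℝ) hsurj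
  have e : (fun x : E d => (inner ℝ v x : ℝ)) = innerₛₗ ℝ v := rfl
  rw [e, hc]
  exact Measure.smul_absolutelyContinuous

/-- Zero variance would put all the mass on a hyperplane, which is null for a law with a density. -/
lemma pdfDirStd_pos (hf : IsPDF f) (hs : IsSubGaussian f) {v : E d} (hv : v ≠ 0) :
    0 < pdfDirStd f v := by
  have := hf.isProbabilityMeasure
  have h0 : 0 ≤ pdfDirStd f v := Real.sqrt_nonneg _
  refine lt_of_le_of_ne h0 fun hz => ?_
  have h1 := pdfDirStd_sq hf hs v
  have hint : Integrable (fun x => centred f v x ^ 2) (law f) :=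
    ((memLp_centred hs v).mono_exponent (p := 2) (by norm_num)).integrable_sq
  rw [← hz, eq_comm, zero_pow two_ne_zero, integral_eq_zero_iff_of_nonneg
    (fun x => sq_nonneg _) hint] at h1
  have hm : Measurable fun x : E d => (inner ℝ v x : ℝ) := by fun_prop
  have hnull : (law f).map (fun x => (inner ℝ v x : ℝ)) {inner ℝ v (pdfMean f)} = 0 :=
    map_inner_absolutelyContinuous hv Real.volume_singleton
  rw [Measure.map_apply hm (measurableSet_singleton _)] at hnull
  have hae : ∀ᵐ x ∂law f, x ∈ (fun x : E d => (inner ℝ v x : ℝ)) ⁻¹' {inner ℝ v (pdfMean f)} := by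
    filter_upwards [h1] with x hx
    have : centred f v x = 0 := by simpa using hx
    rw [centred, inner_sub_right, sub_eq_zero] at this
    exact this
  have hone := prob_compl_eq_zero_iff (μ := law f) (hm (measurableSet_singleton
    (inner ℝ v (pdfMean f) : ℝ)))
  have h2 := hone.1 (mem_ae_iff.1 hae)
  rw [hnull] at h2
  exact zero_ne_one h2

lemma real_slab_law_le (hac : AntiConcentration f) {u : E d} (hu : ‖u‖ = 1) (a : ℝ) {r : ℝ}
    (hr : 0 ≤ r) : (law f).real {x | |inner ℝ u x - a| ≤ r} ≤ 8 * r / pdfDirStd f u := by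
  have hu0 : u ≠ 0 := fun h => by simp [h] at hu
  have hm : Measurable fun x : E d => (inner ℝ u x : ℝ) := by fun_prop
  have hsf : SFinite (law f) := by unfold law; infer_instance
  have hpdf : HasPDF (fun x : E d => (inner ℝ u x : ℝ)) (law f) volume :=
    hasPDF_iff.2 ⟨hm.aemeasurable, inferInstance, map_inner_absolutelyContinuous hu0⟩
  have hset : {x : E d | |inner ℝ u x - a| ≤ r} =
      (fun x : E d => (inner ℝ u x : ℝ)) ⁻¹' Set.Icc (a - r) (a + r) := by
    ext x
    simp only [Set.mem_ofPred_eq, Set.mem_preimage, Set.mem_Icc, abs_le]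
    constructor <;> rintro ⟨h1, h2⟩ <;> constructor <;> linarith
  have h1 : (law f) {x : E d | |inner ℝ u x - a| ≤ r} ≤
      ENNReal.ofReal (4 / pdfDirStd f u) * ENNReal.ofReal (2 * r) := by
    rw [hset, ← Measure.map_apply hm measurableSet_Icc,
      map_eq_setLIntegral_pdf (fun x : E d => (inner ℝ u x : ℝ)) (law f) volume measurableSet_Icc]
    calc _ ≤ ∫⁻ _ in Set.Icc (a - r) (a + r), ENNReal.ofReal (4 / pdfDirStd f u) :=
          lintegral_mono_ae (ae_restrict_of_ae (hac u hu))
      _ = _ := by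
          rw [setLIntegral_const, Real.volume_Icc]; congr 2; ring
  have h0 : 0 ≤ pdfDirStd f u := Real.sqrt_nonneg _
  rw [← ENNReal.ofReal_mul (by positivity)] at h1
  refine (ENNReal.toReal_mono ENNReal.ofReal_ne_top h1).trans_eq ?_
  rw [ENNReal.toReal_ofReal (by positivity)]
  ring

end

/-! ### Covariance matrix and whitening. -/

section

variable {d : ℕ} {f : E d → ℝ}

lemma isHermitian_covMatrix (f : E d → ℝ) : (covMatrix f).IsHermitian := by
  refine Matrix.IsHermitian.ext fun i j => ?_
  simp [covMatrix, covariance_comm]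

lemma pdfDirStd_sq_eq_dotProduct (hf : IsPDF f) (hs : IsSubGaussian f) (v : E d) :
    pdfDirStd f v ^ 2 = v.ofLp ⬝ᵥ (covMatrix f).mulVec v.ofLp := by
  have := hf.isProbabilityMeasure
  have hc : ∀ i, MemLp (fun x : E d => x i - pdfMean f i) 2 (law f) := fun i => by
    have := (memLp_centred hs (EuclideanSpace.single i (1 : ℝ))).mono_exponent (p := 2) (by norm_num)
    unfold centred at this
    simpa [EuclideanSpace.inner_single_left] using this
  have hmean : ∀ i, ∫ x : E d, x i ∂law f = pdfMean f i := fun i => by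
    have := integral_inner_law hf hs (EuclideanSpace.single i (1 : ℝ))
    simpa [EuclideanSpace.inner_single_left] using this
  have hcov : ∀ i j, covMatrix f i j =
      ∫ x : E d, (x i - pdfMean f i) * (x j - pdfMean f j) ∂law f := fun i j => by
    simp only [covMatrix, Matrix.of_apply, covariance, hmean]
  have e : ∀ x : E d, centred f v x ^ 2 =
      ∑ i, ∑ j, v i * v j * ((x i - pdfMean f i) * (x j - pdfMean f j)) := fun x => by
    rw [centred, inner_eq_sum, sq, Finset.sum_mul_sum]
    refine Finset.sum_congr rfl fun i _ => Finset.sum_congr rfl fun j _ => ?_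
    simp only [PiLp.sub_apply]; ring
  have hint : ∀ i j, Integrable
      (fun x : E d => v i * v j * ((x i - pdfMean f i) * (x j - pdfMean f j))) (law f) :=
    fun i j => ((hc i).integrable_mul (hc j)).const_mul _
  rw [pdfDirStd_sq hf hs]
  simp only [e]
  rw [integral_finsetSum _ fun i _ => integrable_finsetSum _ fun j _ => hint i j]
  simp only [fun i => integral_finsetSum Finset.univ fun j _ => hint i j, integral_const_mul,
    ← hcov, dotProduct, Matrix.mulVec, Finset.mul_sum]
  refine Finset.sum_congr rfl fun i _ => Finset.sum_congr rfl fun j _ => ?_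
  ring

/-- The eigenvalues of the covariance matrix. -/
noncomputable def covEig (f : E d → ℝ) : Fin d → ℝ := (isHermitian_covMatrix f).eigenvalues

/-- An orthonormal eigenbasis of the covariance matrix. -/
noncomputable def covBasis (f : E d → ℝ) : OrthonormalBasis (Fin d) ℝ (E d) :=
  (isHermitian_covMatrix f).eigenvectorBasis

lemma pdfDirStd_sq_eq_sum (hf : IsPDF f) (hs : IsSubGaussian f) (v : E d) :
    pdfDirStd f v ^ 2 = ∑ i, covEig f i * (inner ℝ (covBasis f i) v : ℝ) ^ 2 := by
  have hT : ∀ i, (inner ℝ (covBasis f i) (WithLp.toLp 2 ((covMatrix f).mulVec v.ofLp) : E d) : ℝ)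
      = covEig f i * inner ℝ (covBasis f i) v := fun i => by
    have h1 : (inner ℝ (covBasis f i) (WithLp.toLp 2 ((covMatrix f).mulVec v.ofLp) : E d) : ℝ) =
        (covBasis f i).ofLp ⬝ᵥ (covMatrix f).mulVec v.ofLp := by
      rw [inner_eq_sum]; rfl
    have ht : (covMatrix f).transpose = covMatrix f := by
      have := isHermitian_covMatrix f
      rwa [Matrix.IsHermitian, Matrix.conjTranspose_eq_transpose_of_trivial] at this
    rw [h1, Matrix.dotProduct_mulVec, ← Matrix.mulVec_transpose, ht, covBasis,
      Matrix.IsHermitian.mulVec_eigenvectorBasis, smul_dotProduct, inner_eq_sum]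
    rfl
  have h2 : pdfDirStd f v ^ 2 = inner ℝ v (WithLp.toLp 2 ((covMatrix f).mulVec v.ofLp) : E d) := by
    rw [pdfDirStd_sq_eq_dotProduct hf hs, inner_eq_sum]; rfl
  rw [h2, ← (covBasis f).sum_inner_mul_inner]
  refine Finset.sum_congr rfl fun i _ => ?_
  rw [hT, real_inner_comm]; ring

lemma covEig_eq (hf : IsPDF f) (hs : IsSubGaussian f) (i : Fin d) :
    covEig f i = pdfDirStd f (covBasis f i) ^ 2 := by
  rw [pdfDirStd_sq_eq_sum hf hs]
  simp [OrthonormalBasis.inner_eq_ite]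

lemma covEig_pos (hf : IsPDF f) (hs : IsSubGaussian f) (i : Fin d) : 0 < covEig f i := by
  rw [covEig_eq hf hs]
  exact pow_pos (pdfDirStd_pos hf hs ((covBasis f).orthonormal.ne_zero i)) 2

lemma spectrum_covMatrix (f : E d → ℝ) : spectrum ℝ (covMatrix f) = Set.range (covEig f) :=
  (isHermitian_covMatrix f).spectrum_real_eq_range_eigenvalues

lemma sInf_spectrum_le (f : E d → ℝ) (i : Fin d) :
    sInf (spectrum ℝ (covMatrix f)) ≤ covEig f i := by
  rw [spectrum_covMatrix]
  exact csInf_le (Set.finite_range _).bddBelow ⟨i, rfl⟩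

lemma sInf_spectrum_pos (hf : IsPDF f) (hs : IsSubGaussian f) (hd : 1 ≤ d) :
    0 < sInf (spectrum ℝ (covMatrix f)) := by
  rw [spectrum_covMatrix]
  obtain ⟨i, hi⟩ := Set.Nonempty.csInf_mem (s := Set.range (covEig f))
    ⟨_, ⟨⟨0, hd⟩, rfl⟩⟩ (Set.finite_range _)
  rw [← hi]
  exact covEig_pos hf hs i

/-- The standardised coordinates of `x`. -/
noncomputable def whiten (f : E d → ℝ) (x : E d) : E d :=
  WithLp.toLp 2 fun i => (inner ℝ (covBasis f i) (x - pdfMean f) : ℝ) / Real.sqrt (covEig f i)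

/-- The direction in standardised coordinates that corresponds to `v`. -/
noncomputable def whitenDir (f : E d → ℝ) (v : E d) : E d :=
  WithLp.toLp 2 fun i => Real.sqrt (covEig f i) * inner ℝ (covBasis f i) v

/-- The direction that corresponds to the direction `b` in standardised coordinates. -/
noncomputable def unwhitenDir (f : E d → ℝ) (b : E d) : E d :=
  ∑ i, (b i / Real.sqrt (covEig f i)) • covBasis f i

lemma measurable_whiten (f : E d → ℝ) : Measurable (whiten f) := by
  unfold whiten
  refine (PiLp.continuous_toLp 2 _).measurable.comp (measurable_pi_lambda _ fun i => ?_)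
  fun_prop

lemma inner_whitenDir_whiten (hf : IsPDF f) (hs : IsSubGaussian f) (v x : E d) :
    (inner ℝ (whitenDir f v) (whiten f x) : ℝ) = inner ℝ v (x - pdfMean f) := by
  rw [inner_eq_sum, ← (covBasis f).sum_inner_mul_inner]
  refine Finset.sum_congr rfl fun i _ => ?_
  have := Real.sqrt_pos.2 (covEig_pos hf hs i)
  rw [real_inner_comm (covBasis f i) v]
  simp only [whitenDir, whiten]
  field_simp

/-- `whitenDir` is Σ^(1/2) in eigenbasis coordinates, and |Σ^(1/2)v|² = vᵀΣv. -/
lemma norm_whitenDir (hf : IsPDF f) (hs : IsSubGaussian f) (v : E d) :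
    ‖whitenDir f v‖ = pdfDirStd f v := by
  rw [← sq_eq_sq₀ (norm_nonneg _) (show 0 ≤ pdfDirStd f v from Real.sqrt_nonneg _), pdfDirStd_sq_eq_sum hf hs,
    EuclideanSpace.real_norm_sq_eq]
  refine Finset.sum_congr rfl fun i _ => ?_
  simp only [whitenDir, mul_pow]
  rw [Real.sq_sqrt (covEig_pos hf hs i).le]

lemma inner_unwhitenDir (b : E d) (i : Fin d) :
    (inner ℝ (covBasis f i) (unwhitenDir f b) : ℝ) = b i / Real.sqrt (covEig f i) := by
  simp [unwhitenDir, inner_sum, inner_smul_right, OrthonormalBasis.inner_eq_ite]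

lemma whitenDir_unwhitenDir (hf : IsPDF f) (hs : IsSubGaussian f) (b : E d) :
    whitenDir f (unwhitenDir f b) = b := by
  ext i
  have := Real.sqrt_pos.2 (covEig_pos hf hs i)
  simp only [whitenDir, inner_unwhitenDir]
  field_simp

lemma inner_whiten (hf : IsPDF f) (hs : IsSubGaussian f) (b x : E d) :
    (inner ℝ b (whiten f x) : ℝ) = centred f (unwhitenDir f b) x := by
  rw [centred, ← inner_whitenDir_whiten hf hs, whitenDir_unwhitenDir hf hs]

lemma pdfDirStd_unwhitenDir (hf : IsPDF f) (hs : IsSubGaussian f) (b : E d) :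
    pdfDirStd f (unwhitenDir f b) = ‖b‖ := by
  rw [← norm_whitenDir hf hs, whitenDir_unwhitenDir hf hs]

/-- The inverse map Σ^(-1/2) has norm at most λ_min^(-1/2); this is how the shape parameter enters.
-/
lemma norm_unwhitenDir_le (hf : IsPDF f) (hs : IsSubGaussian f) (hd : 1 ≤ d) (b : E d) :
    ‖unwhitenDir f b‖ ≤ ‖b‖ / Real.sqrt (sInf (spectrum ℝ (covMatrix f))) := by
  have h0 := sInf_spectrum_pos hf hs hd
  refine le_of_sq_le_sq ?_ (by positivity)
  rw [div_pow, Real.sq_sqrt h0.le, EuclideanSpace.real_norm_sq_eq b, Finset.sum_div,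
    ← real_inner_self_eq_norm_sq, ← (covBasis f).sum_inner_mul_inner]
  refine Finset.sum_le_sum fun i _ => ?_
  rw [real_inner_comm (covBasis f i), inner_unwhitenDir, ← sq, div_pow,
    Real.sq_sqrt (covEig_pos hf hs i).le]
  gcongr
  exact sInf_spectrum_le f i

lemma sqrt_pow_even (k j : ℕ) : Real.sqrt k ^ (2 * j) = (k : ℝ) ^ j := by
  rw [pow_mul, Real.sq_sqrt (Nat.cast_nonneg k)]

/-- A moment of order 2j is at most (√(2j) · ‖F‖_sg · |Σ^(-1/2)b|)^(2j). The constants 16, 216, 4096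
are 4², 6³, 8⁴. -/
lemma isWhite_map_whiten (hf : IsPDF f) (hs : IsSubGaussian f) (hd : 1 ≤ d) :
    IsWhite (shape f) ((law f).map (whiten f)) := by
  have hm := measurable_whiten f
  have hpow : ∀ (b : E d) (k : ℕ), ∫ y, (inner ℝ b y : ℝ) ^ k ∂((law f).map (whiten f)) =
      ∫ x, centred f (unwhitenDir f b) x ^ k ∂law f := fun b k => by
    rw [integral_map hm.aemeasurable (by fun_prop)]
    simp only [inner_whiten hf hs]
  have hmom : ∀ (b : E d) (j : ℕ), 1 ≤ j → 2 * j ≤ 8 →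
      ∫ y, (inner ℝ b y : ℝ) ^ (2 * j) ∂((law f).map (whiten f)) ≤
        (2 * j : ℕ) ^ j * shape f ^ (2 * j) * ‖b‖ ^ (2 * j) := fun b j hj hj8 => by
    rw [hpow]
    refine (integral_centred_pow_le hs (by omega) hj8 (even_two_mul j) hf _).trans ?_
    rw [← sqrt_pow_even, ← mul_pow, ← mul_pow, mul_assoc (Real.sqrt _)]
    refine pow_le_pow_left₀ (by positivity) (mul_le_mul_of_nonneg_left ?_ (Real.sqrt_nonneg _)) _
    calc _ ≤ (pdfSgNorm f).toReal * (‖b‖ / Real.sqrt (sInf (spectrum ℝ (covMatrix f)))) := by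
          gcongr; exact norm_unwhitenDir_le hf hs hd b
      _ = _ := by rw [shape]; ring
  refine ⟨?_, fun b => ?_, fun b => ?_, fun b => ?_, fun b => ?_, fun b => ?_⟩
  · refine (memLp_map_measure_iff (by fun_prop) hm.aemeasurable).2 (MemLp.of_eval_piLp fun i => ?_)
    have := (memLp_centred hs (covBasis f i)).mul_const (Real.sqrt (covEig f i))⁻¹
    simpa [whiten, centred, Function.comp_def, div_eq_mul_inv] using this
  · have := hpow b 1
    simp only [pow_one] at this
    rw [this, integral_centred hf hs]
  · rw [hpow, ← pdfDirStd_sq hf hs, pdfDirStd_unwhitenDir hf hs]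
  · have := hmom b 2 (by norm_num) (by norm_num)
    norm_num at this; exact this
  · have := hmom b 3 (by norm_num) (by norm_num)
    norm_num at this; exact this
  · have := hmom b 4 (by norm_num) (by norm_num)
    norm_num at this; exact this

/-- A slab with normal b pulls back to one with normal v = Σ^(-1/2)b. Normalising v divides the
half-width by |v| and gives the deviation |b|/|v|, so |v| cancels. -/
lemma slabBound_map_whiten (hf : IsPDF f) (hs : IsSubGaussian f) (hac : AntiConcentration f) :
    SlabBound ((law f).map (whiten f)) := by
  intro b a r hb hr
  set v := unwhitenDir f b with hv
  have hv0 : v ≠ 0 := fun h0 => hb (by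
    rw [← norm_eq_zero, ← pdfDirStd_unwhitenDir hf hs, ← hv, h0]
    rw [← norm_whitenDir hf hs, norm_eq_zero]; ext i; simp [whitenDir])
  have hvn : 0 < ‖v‖ := norm_pos_iff.2 hv0
  set u : E d := ‖v‖⁻¹ • v with hu
  have hu1 : ‖u‖ = 1 := norm_smul_inv_norm (𝕜 := ℝ) hv0
  have hstd : pdfDirStd f u = ‖b‖ / ‖v‖ := by
    have h1 : whitenDir f u = ‖v‖⁻¹ • b := by
      rw [← whitenDir_unwhitenDir hf hs b]
      ext i
      simp only [whitenDir, hu, inner_smul_right, PiLp.smul_apply, smul_eq_mul, ← hv]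
      ring
    rw [← norm_whitenDir hf hs, h1, norm_smul, norm_inv, norm_norm]; ring
  rw [map_measureReal_apply (measurable_whiten f) (measurableSet_slab _ _ _)]
  have hset : whiten f ⁻¹' slab b a r =
      {x | |inner ℝ u x - (inner ℝ u (pdfMean f) + a / ‖v‖)| ≤ r / ‖v‖} := by
    ext x
    simp only [slab, Set.mem_preimage, Set.mem_ofPred_eq, inner_whiten hf hs, centred, ← hv]
    have e : (inner ℝ u x : ℝ) - (inner ℝ u (pdfMean f) + a / ‖v‖) =
        (inner ℝ v (x - pdfMean f) - a) / ‖v‖ := by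
      rw [hu, inner_smul_left, inner_smul_left, inner_sub_right]
      simp; field_simp; ring
    rw [e, abs_div, abs_of_pos hvn, div_le_div_iff_of_pos_right hvn]
  rw [hset]
  refine (real_slab_law_le hac hu1 _ (by positivity)).trans_eq ?_
  rw [hstd]
  have : 0 < ‖b‖ := norm_pos_iff.2 hb
  field_simp

end

/-! ### Transfer back to the original coordinates. -/

section

variable {d : ℕ} {f : E d → ℝ} {ι : Type*}

lemma dirStd_nonneg (x : ι → E d) (S : Finset ι) (v : E d) : 0 ≤ dirStd x S v := Real.sqrt_nonneg _

lemma dirStd_smul (x : ι → E d) (S : Finset ι) (c : ℝ) (v : E d) :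
    dirStd x S (c • v) = |c| * dirStd x S v := by
  have : (S.card : ℝ)⁻¹ * ∑ i ∈ S, (inner ℝ (c • v) (x i - mean x S) : ℝ) ^ 2 =
      c ^ 2 * ((S.card : ℝ)⁻¹ * ∑ i ∈ S, (inner ℝ v (x i - mean x S) : ℝ) ^ 2) := by
    simp only [inner_smul_left, mul_pow, ← Finset.mul_sum]
    simp; ring
  rw [dirStd, dirStd, this, Real.sqrt_mul (sq_nonneg c), Real.sqrt_sq_eq_abs]

lemma mean_sub (x : ι → E d) {S : Finset ι} (hS : S.Nonempty) (m : E d) :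
    mean x S - m = (S.card : ℝ)⁻¹ • ∑ i ∈ S, (x i - m) := by
  have : (S.card : ℝ) ≠ 0 := by exact_mod_cast hS.card_pos.ne'
  rw [Finset.sum_sub_distrib, smul_sub, Finset.sum_const, ← Nat.cast_smul_eq_nsmul ℝ,
    smul_smul, inv_mul_cancel₀ this, one_smul, mean]

lemma inner_mean_sub_pdfMean (hf : IsPDF f) (hs : IsSubGaussian f) (x : ι → E d) {S : Finset ι}
    (hS : S.Nonempty) (v : E d) : (inner ℝ v (mean x S - pdfMean f) : ℝ) =
      inner ℝ (whitenDir f v) (mean (fun i => whiten f (x i)) S) := by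
  rw [mean_sub x hS, mean, inner_smul_right, inner_smul_right, inner_sum, inner_sum]
  simp only [inner_whitenDir_whiten hf hs]

lemma dirStd_eq_whiten (hf : IsPDF f) (hs : IsSubGaussian f) (x : ι → E d) (S : Finset ι)
    (v : E d) : dirStd x S v = dirStd (fun i => whiten f (x i)) S (whitenDir f v) := by
  rw [dirStd, dirStd]
  congr 2
  refine Finset.sum_congr rfl fun i hi => ?_
  rw [inner_sub_right (whitenDir f v), inner_whitenDir_whiten hf hs,
    -- The index at hand shows that S is nonempty, so the empty set needs no separate case.
    ← inner_mean_sub_pdfMean hf hs x ⟨i, hi⟩, ← inner_sub_right]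
  congr 2
  abel

lemma dirStd_le_of_second {y : ι → E d} {C : Finset ι} (hC : GoodMoments y C) (b : E d) :
    dirStd y C b ≤ 2 * ‖b‖ := by
  have hc : (0 : ℝ) < C.card := by exact_mod_cast hC.nonempty.card_pos
  have hsum : ∑ i ∈ C, (inner ℝ b (y i) : ℝ) = C.card * inner ℝ b (mean y C) := by
    rw [mean, inner_smul_right, inner_sum]; field_simp
  refine Real.sqrt_le_iff.2 ⟨by positivity, ?_⟩
  rw [inv_mul_le_iff₀ hc]
  have e : ∑ i ∈ C, (inner ℝ b (y i - mean y C) : ℝ) ^ 2 =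
      ∑ i ∈ C, (inner ℝ b (y i) : ℝ) ^ 2 - C.card * (inner ℝ b (mean y C) : ℝ) ^ 2 := by
    have : ∀ i, (inner ℝ b (y i - mean y C) : ℝ) ^ 2 = (inner ℝ b (y i) : ℝ) ^ 2
        - 2 * inner ℝ b (mean y C) * inner ℝ b (y i) + (inner ℝ b (mean y C) : ℝ) ^ 2 := fun i => by
      rw [inner_sub_right]; ring
    simp only [this, Finset.sum_add_distrib, Finset.sum_sub_distrib, ← Finset.mul_sum, hsum,
      Finset.sum_const, nsmul_eq_mul]
    ring
  rw [e]
  have := hC.second_le b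
  nlinarith [mul_nonneg hc.le (sq_nonneg (inner ℝ b (mean y C) : ℝ))]

lemma pdfDirStd_le_pdfStd (hf : IsPDF f) (hs : IsSubGaussian f) {v : E d} (hv : ‖v‖ = 1) :
    pdfDirStd f v ≤ pdfStd f := by
  refine le_ciSup (f := fun v : Metric.sphere (0 : E d) 1 => pdfDirStd f v)
    ⟨Real.sqrt (∑ i, covEig f i), ?_⟩ (⟨v, by simpa using hv⟩ : Metric.sphere (0 : E d) 1)
  rintro _ ⟨⟨u, hu⟩, rfl⟩
  have hu1 : ‖u‖ = 1 := by simpa using hu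
  refine Real.le_sqrt_of_sq_le ?_
  rw [pdfDirStd_sq_eq_sum hf hs]
  refine Finset.sum_le_sum fun i _ => mul_le_of_le_one_right (covEig_pos hf hs i).le ?_
  have h1 := abs_real_inner_le_norm (covBasis f i) u
  rw [hu1, (covBasis f).orthonormal.1 i, one_mul] at h1
  rw [← sq_abs]
  exact pow_le_one₀ (abs_nonneg _) h1

lemma pdfStd_nonneg (f : E d → ℝ) : 0 ≤ pdfStd f :=
  Real.iSup_nonneg fun _ => Real.sqrt_nonneg _

lemma norm_mean_sub_pdfMean_le (hf : IsPDF f) (hs : IsSubGaussian f) {x : ι → E d} {C : Finset ι}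
    (hC : GoodMoments (fun i => whiten f (x i)) C) : ‖mean x C - pdfMean f‖ ≤ 2 * pdfStd f := by
  set z := mean x C - pdfMean f with hz
  rcases eq_or_ne z 0 with h0 | h0
  · rw [h0, norm_zero]; exact mul_nonneg zero_le_two (pdfStd_nonneg f)
  set v : E d := ‖z‖⁻¹ • z with hv
  have hv1 : ‖v‖ = 1 := norm_smul_inv_norm (𝕜 := ℝ) h0
  have hzn : 0 < ‖z‖ := norm_pos_iff.2 h0
  have h1 : (inner ℝ v z : ℝ) = ‖z‖ := by
    rw [hv, inner_smul_left, real_inner_self_eq_norm_sq]; simp; field_simp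
  rw [← h1, hz, inner_mean_sub_pdfMean hf hs x hC.nonempty]
  refine (real_inner_le_norm _ _).trans ?_
  rw [norm_whitenDir hf hs, mul_comm]
  exact mul_le_mul hC.mean_le (pdfDirStd_le_pdfStd hf hs hv1) (Real.sqrt_nonneg _) zero_le_two

lemma dirStd_le_pdfDirStd (hf : IsPDF f) (hs : IsSubGaussian f) {x : ι → E d} {C : Finset ι}
    (hC : GoodMoments (fun i => whiten f (x i)) C) (v : E d) :
    dirStd x C v ≤ 2 * pdfDirStd f v := by
  rw [dirStd_eq_whiten hf hs, ← norm_whitenDir hf hs]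
  exact dirStd_le_of_second hC _

lemma std_le_pdfStd (hf : IsPDF f) (hs : IsSubGaussian f) (hd : 1 ≤ d) {x : ι → E d}
    {C : Finset ι} (hC : GoodMoments (fun i => whiten f (x i)) C) : std x C ≤ 2 * pdfStd f := by
  have : Nonempty (Metric.sphere (0 : E d) 1) :=
    ⟨⟨EuclideanSpace.single ⟨0, hd⟩ (1 : ℝ), by simp⟩⟩
  refine ciSup_le fun v => (dirStd_le_pdfDirStd hf hs hC v).trans ?_
  have := pdfDirStd_le_pdfStd hf hs (v := v) (by simp)
  linarith

lemma goodSample_of_goodMoments (hf : IsPDF f) (hs : IsSubGaussian f) {m : ℕ} {x : Fin m → E d}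
    {γ : ℝ} (hγ : 2 ≤ γ) (hC : GoodMoments (fun i => whiten f (x i)) Finset.univ) :
    GoodSample γ f x :=
  ⟨(norm_mean_sub_pdfMean_le hf hs hC).trans
    (mul_le_mul_of_nonneg_right hγ (pdfStd_nonneg f)), fun v _ => dirStd_le_pdfDirStd hf hs hC v⟩

/-- With M the largest deviation of a density, each mean moves by at most 2M and each sample
deviation is at most 2M, so 6γM - 4M ≥ 2γM suffices. -/
lemma wellSeparated_of_goodMoments {n k : ℕ} {f : Fin k → E d → ℝ} (hf : ∀ ℓ, IsPDF (f ℓ))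
    (hs : ∀ ℓ, IsSubGaussian (f ℓ)) (hd : 1 ≤ d) {γ : ℝ} (hγ : 2 ≤ γ) {x : Fin n → E d}
    {C : Fin k → Finset (Fin n)}
    (hC : ∀ ℓ, GoodMoments (fun i => whiten (f ℓ) (x i)) (C ℓ))
    (hsep : ∀ ℓ ℓ', ℓ ≠ ℓ' →
      6 * γ * (⨆ r, pdfStd (f r)) ≤ ‖pdfMean (f ℓ) - pdfMean (f ℓ')‖) :
    WellSeparated γ x C := by
  refine ⟨fun ℓ => (hC ℓ).nonempty, fun ℓ ℓ' hne => ?_⟩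
  set M := ⨆ r, pdfStd (f r) with hM
  have hle : ∀ r, pdfStd (f r) ≤ M := fun r =>
    le_ciSup (f := fun r => pdfStd (f r)) (Set.finite_range _).bddAbove r
  have hM0 : 0 ≤ M := (pdfStd_nonneg (f ℓ)).trans (hle ℓ)
  have : Nonempty (Fin k) := ⟨ℓ⟩
  have h1 : (⨆ r, std x (C r)) ≤ 2 * M := ciSup_le fun r =>
    (std_le_pdfStd (hf r) (hs r) hd (hC r)).trans (by linarith [hle r])
  have h2 : ∀ r, ‖mean x (C r) - pdfMean (f r)‖ ≤ 2 * M := fun r =>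
    (norm_mean_sub_pdfMean_le (hf r) (hs r) (hC r)).trans (by linarith [hle r])
  have h3 := hsep ℓ ℓ' hne
  have e : pdfMean (f ℓ) - pdfMean (f ℓ') = (mean x (C ℓ) - mean x (C ℓ'))
      - (mean x (C ℓ) - pdfMean (f ℓ)) + (mean x (C ℓ') - pdfMean (f ℓ')) := by abel
  have h4 : ‖pdfMean (f ℓ) - pdfMean (f ℓ')‖ ≤ ‖mean x (C ℓ) - mean x (C ℓ')‖
      + ‖mean x (C ℓ) - pdfMean (f ℓ)‖ + ‖mean x (C ℓ') - pdfMean (f ℓ')‖ := by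
    rw [e]
    exact (norm_add_le _ _).trans (add_le_add (norm_sub_le _ _) le_rfl)
  have h5 : γ * (⨆ r, std x (C r)) ≤ γ * (2 * M) :=
    mul_le_mul_of_nonneg_left h1 (by linarith)
  nlinarith [h2 ℓ, h2 ℓ', mul_le_mul_of_nonneg_right hγ hM0]

/-- In direction v the projected points have deviation |⟨v,u⟩| times that along u, with maximum at v
= u. -/
lemma std_starProjection_eq (x : ι → E d) (S : Finset ι) {u : E d} (hu : ‖u‖ = 1) :
    std (fun i => (ℝ ∙ u).starProjection (x i)) S = dirStd x S u := by
  have h1 : ∀ v : E d, dirStd (fun i => (ℝ ∙ u).starProjection (x i)) S v =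
      |(inner ℝ v u : ℝ)| * dirStd x S u := fun v => by
    rw [← dirStd_smul, dirStd, dirStd]
    congr 2
    refine Finset.sum_congr rfl fun i _ => ?_
    have hm : mean (fun i => (ℝ ∙ u).starProjection (x i)) S =
        (ℝ ∙ u).starProjection (mean x S) := by
      simp [mean, map_smul, map_sum]
    rw [hm, ← map_sub, Submodule.starProjection_unit_singleton ℝ hu, inner_smul_right,
      inner_smul_left, mul_comm]
    rfl
  have hle : ∀ v : Metric.sphere (0 : E d) 1,
      dirStd (fun i => (ℝ ∙ u).starProjection (x i)) S v ≤ dirStd x S u := fun v => by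
    have hv : ‖(v : E d)‖ = 1 := by simp
    rw [h1]
    refine mul_le_of_le_one_left (dirStd_nonneg _ _ _) ?_
    have := abs_real_inner_le_norm (v : E d) u
    rwa [hv, hu, one_mul] at this
  have : Nonempty (Metric.sphere (0 : E d) 1) := ⟨⟨u, by simpa using hu⟩⟩
  refine le_antisymm (ciSup_le hle) ?_
  have h2 := le_ciSup (f := fun v : Metric.sphere (0 : E d) 1 =>
    dirStd (fun i => (ℝ ∙ u).starProjection (x i)) S v)
    ⟨dirStd x S u, by rintro _ ⟨v, rfl⟩; exact hle v⟩ ⟨u, by simpa using hu⟩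
  rw [h1, real_inner_self_eq_norm_sq, hu] at h2
  simp only [one_pow, abs_one, one_mul] at h2
  exact h2

lemma exists_unit_span {L : Submodule ℝ (E d)} (hL : Module.finrank ℝ L = 1) :
    ∃ u : E d, ‖u‖ = 1 ∧ L = ℝ ∙ u := by
  obtain ⟨v, hv0, hspan⟩ := finrank_eq_one_iff'.1 hL
  have hvL := v.2
  have hv : (v : E d) ≠ 0 := fun h => hv0 (Subtype.ext h)
  set u : E d := ‖(v : E d)‖⁻¹ • (v : E d) with hu
  have hu1 : ‖u‖ = 1 := norm_smul_inv_norm (𝕜 := ℝ) hv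
  refine ⟨u, hu1, ?_⟩
  · refine le_antisymm (fun w hw => ?_) ((Submodule.span_singleton_le_iff_mem _ _).2
      (L.smul_mem _ hvL))
    obtain ⟨c, hc⟩ := hspan ⟨w, hw⟩
    refine Submodule.mem_span_singleton.2 ⟨c * ‖(v : E d)‖, ?_⟩
    have hc' : c • (v : E d) = w := congrArg Subtype.val hc
    rw [hu, smul_smul, mul_assoc, mul_inv_cancel₀ (norm_ne_zero_iff.2 hv), mul_one, hc']

/-- The factor 2 in `Spread` pays for the full cluster's deviation, which may be twice that of the
density. -/
lemma ntsc_of_spread {n k : ℕ} {f : Fin k → E d → ℝ} (hf : ∀ ℓ, IsPDF (f ℓ))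
    (hs : ∀ ℓ, IsSubGaussian (f ℓ)) {x : Fin n → E d} {C : Fin k → Finset (Fin n)}
    (hC : ∀ ℓ, GoodMoments (fun i => whiten (f ℓ) (x i)) (C ℓ))
    (hsp : ∀ ℓ, Spread (fun i => whiten (f ℓ) (x i)) (C ℓ)) : NTSC x C := by
  intro ℓ T hT ht L hL
  obtain ⟨u, hu1, rfl⟩ := exists_unit_span hL
  rw [std_starProjection_eq x _ hu1, std_starProjection_eq x _ hu1, ← mul_pow]
  refine pow_le_pow_left₀ (mul_nonneg (by positivity) (dirStd_nonneg _ _ _)) ?_ 2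
  have h1 := dirStd_le_pdfDirStd (hf ℓ) (hs ℓ) (hC ℓ) u
  have hpos : 0 < pdfDirStd (f ℓ) u :=
    pdfDirStd_pos (hf ℓ) (hs ℓ) fun h0 => by simp [h0] at hu1
  set b := whitenDir (f ℓ) u with hb
  have hbn : ‖b‖ = pdfDirStd (f ℓ) u := norm_whitenDir (hf ℓ) (hs ℓ) u
  have hb0 : b ≠ 0 := norm_pos_iff.1 (hbn ▸ hpos)
  have h2 := hsp ℓ T hT ht (‖b‖⁻¹ • b) (norm_smul_inv_norm (𝕜 := ℝ) hb0)
  rw [dirStd_smul, abs_of_nonneg (by positivity), ← dirStd_eq_whiten (hf ℓ) (hs ℓ), hbn,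
    le_inv_mul_iff₀ hpos] at h2
  calc (T.card : ℝ) / (125 * (C ℓ).card) * dirStd x (C ℓ) u
      ≤ (T.card : ℝ) / (125 * (C ℓ).card) * (2 * pdfDirStd (f ℓ) u) := by gcongr
    _ = pdfDirStd (f ℓ) u * (2 * T.card / (125 * (C ℓ).card)) := by ring
    _ ≤ _ := h2

end

/-! ### Labelled mixture and failure probability. -/

section

variable {d : ℕ}

lemma isProbabilityMeasure_labelledMixture {k : ℕ} {w : Fin k → ℝ} {f : Fin k → E d → ℝ}
    (hf : ∀ ℓ, IsPDF (f ℓ)) (hw : ∀ ℓ, 0 ≤ w ℓ) (hsum : ∑ ℓ, w ℓ = 1) :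
    IsProbabilityMeasure (labelledMixture w f) := by
  have := fun ℓ => (hf ℓ).isProbabilityMeasure
  refine ⟨?_⟩
  simp only [labelledMixture, Measure.coe_finsetSum, Finset.sum_apply, Measure.smul_apply,
    measure_univ, smul_eq_mul, mul_one]
  rw [← ENNReal.ofReal_sum_of_nonneg fun ℓ _ => hw ℓ, hsum, ENNReal.ofReal_one]

lemma hasLawOn_labelledMixture {k : ℕ} {w : Fin k → ℝ} {f : Fin k → E d → ℝ}
    (hf : ∀ ℓ, IsPDF (f ℓ)) {ℓ : Fin k} (hw : 0 < w ℓ) :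
    HasLawOn (labelledMixture w f) {p | p.1 = ℓ} (fun p => whiten (f ℓ) p.2) (w ℓ)
      ((law (f ℓ)).map (whiten (f ℓ))) := by
  have := fun ℓ => (hf ℓ).isProbabilityMeasure
  have hm := measurable_whiten (f ℓ)
  have hA : MeasurableSet {p : Fin k × E d | p.1 = ℓ} := measurable_fst (measurableSet_singleton ℓ)
  have hY : Measurable fun p : Fin k × E d => whiten (f ℓ) p.2 := hm.comp measurable_snd
  refine ⟨hA, hY, hw, Measure.ext fun B hB => ?_⟩
  rw [Measure.map_apply hY hB, Measure.restrict_apply (hY hB), Measure.smul_apply,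
    Measure.map_apply hm hB, labelledMixture, Measure.coe_finsetSum, Finset.sum_apply]
  rw [Finset.sum_eq_single ℓ]
  · rw [Measure.smul_apply, Measure.dirac_prod, Measure.map_apply measurable_prodMk_left
      ((hY hB).inter hA)]
    congr 2
    ext x; simp
  · intro j _ hj
    rw [Measure.smul_apply, Measure.dirac_prod, Measure.map_apply measurable_prodMk_left
      ((hY hB).inter hA)]
    have : Prod.mk j ⁻¹' ((fun p : Fin k × E d => whiten (f ℓ) p.2) ⁻¹' B ∩ {p | p.1 = ℓ}) = ∅ := by
      ext x; simp [hj]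
    rw [this, measure_empty, smul_zero]
  · simp

/-- The full event with weight 1 makes a sample from a single density a special case of a cluster.
-/
lemma hasLawOn_univ {f : E d → ℝ} : HasLawOn (law f) Set.univ (whiten f) 1
    ((law f).map (whiten f)) :=
  ⟨MeasurableSet.univ, measurable_whiten f, one_pos, by simp⟩

lemma shape_nonneg (f : E d → ℝ) : 0 ≤ shape f :=
  div_nonneg ENNReal.toReal_nonneg (Real.sqrt_nonneg _)

/-- The failure probability allowed for `n` samples. -/
noncomputable def failureProb (n : ℕ) : ℝ := if n < 700 then 1 else 111 / (n : ℝ) ^ (1 / 5 : ℝ)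

lemma tendsto_failureProb : Tendsto failureProb atTop (𝓝 0) := by
  have h1 : Tendsto (fun n : ℕ => 111 / (n : ℝ) ^ (1 / 5 : ℝ)) atTop (𝓝 0) :=
    tendsto_const_nhds.div_atTop ((tendsto_rpow_atTop (by norm_num)).comp
      tendsto_natCast_atTop_atTop)
  refine h1.congr' ?_
  filter_upwards [eventually_ge_atTop 700] with n hn
  simp [failureProb, not_lt.2 hn]

lemma le_failureProb {α : Type*} [MeasurableSpace α] (P : Measure α) [IsProbabilityMeasure P]
    (S : Set α) (n : ℕ) (h : 700 ≤ n → P.real S ≤ 111 / (n : ℝ) ^ (1 / 5 : ℝ)) :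
    P S ≤ ENNReal.ofReal (failureProb n) := by
  rw [← ofReal_measureReal (μ := P)]
  refine ENNReal.ofReal_le_ofReal ?_
  unfold failureProb
  split_ifs with hn
  · exact measureReal_le_one
  · exact h (not_lt.1 hn)

lemma rpow_fifth_le {n z : ℝ} (hn : 0 ≤ n) (hz : 0 ≤ z) (h : n ≤ z ^ 5) :
    n ^ (1 / 5 : ℝ) ≤ z := by
  calc n ^ (1 / 5 : ℝ) ≤ (z ^ 5) ^ (1 / 5 : ℝ) := Real.rpow_le_rpow hn h (by norm_num)
    _ = z := by
      rw [← Real.rpow_natCast z 5, ← Real.rpow_mul hz]; norm_num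

lemma two_le_sepFactor {K w₀ : ℝ} (hK : 2 ≤ K) (hw : 0 < w₀) (hw1 : w₀ ≤ 1) :
    2 ≤ sepFactor K w₀ := by
  rw [sepFactor, le_div_iff₀ (by positivity)]
  nlinarith [pow_le_one₀ (n := 11) hw.le hw1]

/-- With k ≤ 1/w₀ the claim reduces to n^(1/5) ≤ w₀√(nw₀), which is equivalent to nw₀⁵ ≥ 1. -/
lemma union_arith {n w₀ : ℝ} {k : ℕ} (hn : 1 ≤ n) (hw : 0 < w₀) (hw1 : w₀ ≤ 1)
    (hk : k * w₀ ≤ 1) (h : 100 / w₀ ^ 5 ≤ n) :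
    k * (110 / Real.sqrt (n * w₀) + 1 / n ^ 2) ≤ 111 / n ^ (1 / 5 : ℝ) := by
  have hn0 : 0 < n := by linarith
  set r := Real.sqrt (n * w₀) with hr
  have hr0 : 0 < r := Real.sqrt_pos.2 (by positivity)
  have hr2 : r ^ 2 = n * w₀ := Real.sq_sqrt (by positivity)
  have hrn : r ≤ n ^ 2 := by
    refine le_of_sq_le_sq ?_ (by positivity)
    rw [hr2]
    calc n * w₀ ≤ n * 1 := by gcongr
      _ = n ^ 1 := by ring
      _ ≤ n ^ 4 := pow_le_pow_right₀ hn (by norm_num)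
      _ = _ := by ring
  have hk' : (k : ℝ) ≤ 1 / w₀ := by rwa [le_div_iff₀ hw]
  have hz : n ^ (1 / 5 : ℝ) ≤ w₀ * r := by
    refine rpow_fifth_le hn0.le (by positivity) (le_of_sq_le_sq ?_ (by positivity))
    rw [div_le_iff₀ (by positivity)] at h
    calc n ^ 2 = 1 ^ 3 * n ^ 2 := by ring
      _ ≤ (n * w₀ ^ 5) ^ 3 * n ^ 2 := by gcongr; linarith
      _ = (w₀ ^ 2 * (n * w₀)) ^ 5 := by ring
      _ = _ := by rw [← hr2]; ring
  calc k * (110 / r + 1 / n ^ 2) ≤ 1 / w₀ * (110 / r + 1 / r) := by gcongr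
    _ = 111 / (w₀ * r) := by field_simp; norm_num
    _ ≤ _ := by gcongr

end

end SubGaussianMixture

/-! ### The theorem. -/

theorem mainTheorem5 :
    ∃ c > (0 : ℝ), ∃ K₀ > (0 : ℝ), ∃ δ : ℕ → ℝ, Tendsto δ atTop (𝓝 0) ∧
      (∀ (K w₀ : ℝ) (d k n : ℕ) (w : Fin k → ℝ) (f : Fin k → E d → ℝ),
        K₀ ≤ K → 0 < w₀ → 1 ≤ d →
        (∀ ℓ, w₀ ≤ w ℓ) → ∑ ℓ, w ℓ = 1 →
        (∀ ℓ, IsPDF (f ℓ)) → (∀ ℓ, IsSubGaussian (f ℓ)) → (∀ ℓ, AntiConcentration (f ℓ)) →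
        (∀ ℓ ℓ', ℓ ≠ ℓ' →
          6 * sepFactor K w₀ * (⨆ r, pdfStd (f r)) ≤ ‖pdfMean (f ℓ) - pdfMean (f ℓ')‖) →
        100 / w₀ ^ 5 ≤ (n : ℝ) →
        c * (⨆ ℓ, shape (f ℓ)) ^ 4 * (d : ℝ) ^ 2 / w₀ ≤ (n : ℝ) →
        sampleLaw n w f
            {ω | ¬ (WellSeparated (sepFactor K w₀) (points ω) (cluster ω) ∧
              NTSC (points ω) (cluster ω))}
          ≤ ENNReal.ofReal (δ n)) ∧
      (∀ (K w₀ : ℝ) (d : ℕ) (f : E d → ℝ),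
        K₀ ≤ K → 0 < w₀ → w₀ ≤ 1 → 1 ≤ d → IsPDF f → IsSubGaussian f →
        ∃ s : ℕ, sampleComplexity δ (sepFactor K w₀) f = s ∧
          (s : ℝ) ≤ 100 * shape f ^ 4 * (d : ℝ) ^ 2) := by
  -- Since κ⁴ ≥ 1/16, the value 10¹⁰ ensures n ≥ 8·10⁷d² for the grid bound. K₀ = 2 ensures γ ≥ 2.
  refine ⟨10000000000, by norm_num, 2, by norm_num, failureProb, tendsto_failureProb, ?_, ?_⟩
  · intro K w₀ d k n w f hK hw₀ hd hw hsum hf hs hac hsep hn1 hn2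
    have hwpos : ∀ ℓ, 0 < w ℓ := fun ℓ => hw₀.trans_le (hw ℓ)
    have hprob := isProbabilityMeasure_labelledMixture hf (fun ℓ => (hwpos ℓ).le) hsum
    have hk : k * w₀ ≤ 1 := by
      rw [← hsum]
      calc (k : ℝ) * w₀ = ∑ _ℓ : Fin k, w₀ := by simp
        _ ≤ _ := Finset.sum_le_sum fun ℓ _ => hw ℓ
    have hk0 : 0 < k := by
      rcases Nat.eq_zero_or_pos k with rfl | h
      · simp at hsum
      · exact h
    have hk1 : (1 : ℝ) ≤ k := by exact_mod_cast hk0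
    have hw1 : w₀ ≤ 1 := by nlinarith
    have hγ := two_le_sepFactor hK hw₀ hw1
    refine le_failureProb (Measure.pi fun _ => labelledMixture w f) _ n fun hn700 => ?_
    have hn' : (700 : ℝ) ≤ n := by exact_mod_cast hn700
    refine le_trans ?_ (union_arith (by linarith) hw₀ hw1 hk hn1)
    have hpart : ∀ ℓ, (Measure.pi fun _ : Fin n => labelledMixture w f).real
        {ω | ¬ (GoodMoments (fun i => whiten (f ℓ) (points ω i)) (cluster ω ℓ) ∧
          Spread (fun i => whiten (f ℓ) (points ω i)) (cluster ω ℓ))} ≤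
        110 / Real.sqrt (n * w₀) + 1 / (n : ℝ) ^ 2 := fun ℓ => by
      have := (hf ℓ).isProbabilityMeasure
      have : IsProbabilityMeasure ((law (f ℓ)).map (whiten (f ℓ))) :=
        Measure.isProbabilityMeasure_map (measurable_whiten _).aemeasurable
      have hwh := isWhite_map_whiten (hf ℓ) (hs ℓ) hd
      have hκ1 := hwh.one_le_of_pow_four hd hwh.fourth
      have hshape : shape (f ℓ) ^ 4 ≤ (⨆ ℓ, shape (f ℓ)) ^ 4 :=
        pow_le_pow_left₀ (shape_nonneg _)
          (le_ciSup (f := fun ℓ => shape (f ℓ)) (Set.finite_range _).bddAbove ℓ) 4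
      rw [div_le_iff₀ hw₀] at hn2
      have hd2 : (0 : ℝ) ≤ (d : ℝ) ^ 2 := by positivity
      have hb : 10000000000 * (shape (f ℓ) ^ 4 * (d : ℝ) ^ 2) ≤ n * w₀ := by
        nlinarith [mul_le_mul_of_nonneg_right hshape hd2]
      have hX : 0 ≤ shape (f ℓ) ^ 4 * (d : ℝ) ^ 2 := by positivity
      have hnw : (n : ℝ) * w₀ ≤ n * w ℓ := by gcongr; exact hw ℓ
      have hnw1 : (n : ℝ) * w₀ ≤ n := mul_le_of_le_one_right (by positivity) hw1
      refine ((hasLawOn_labelledMixture hf (hwpos ℓ)).real_not_good_le hwh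
        (slabBound_map_whiten (hf ℓ) (hs ℓ) (hac ℓ)) hn700 hd (by linarith)
        (by nlinarith [mul_le_mul_of_nonneg_right hκ1 hd2]) (C := fun ω => cluster ω ℓ)
        (fun ω i => by simp [cluster])).trans ?_
      gcongr
    have hsub : {ω : Fin n → Fin k × E d | ¬ (WellSeparated (sepFactor K w₀) (points ω) (cluster ω) ∧
        NTSC (points ω) (cluster ω))} ⊆ ⋃ ℓ,
        {ω | ¬ (GoodMoments (fun i => whiten (f ℓ) (points ω i)) (cluster ω ℓ) ∧
          Spread (fun i => whiten (f ℓ) (points ω i)) (cluster ω ℓ))} := by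
      intro ω hω
      by_contra hnot
      simp only [Set.mem_iUnion, Set.mem_ofPred_eq, not_exists, not_not] at hnot
      exact hω ⟨wellSeparated_of_goodMoments hf hs hd hγ (fun ℓ => (hnot ℓ).1) hsep,
        ntsc_of_spread hf hs (fun ℓ => (hnot ℓ).1) fun ℓ => (hnot ℓ).2⟩
    calc _ ≤ _ := measureReal_mono hsub (measure_ne_top _ _)
      _ ≤ ∑ ℓ : Fin k, (110 / Real.sqrt (n * w₀) + 1 / (n : ℝ) ^ 2) :=
          (measureReal_iUnion_fintype_le _).trans (Finset.sum_le_sum fun ℓ _ => hpart ℓ)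
      _ = _ := by rw [Finset.sum_const, Finset.card_univ, Fintype.card_fin, nsmul_eq_mul]
  · intro K w₀ d f hK hw₀ hw1 hd hf hs
    have hprob := hf.isProbabilityMeasure
    have : IsProbabilityMeasure ((law f).map (whiten f)) :=
      Measure.isProbabilityMeasure_map (measurable_whiten _).aemeasurable
    have hγ := two_le_sepFactor hK hw₀ hw1
    have hX : 0 ≤ 100 * shape f ^ 4 * (d : ℝ) ^ 2 := by positivity
    -- The sample complexity is an integer, so the floor is needed. From m + 1 > 100κ⁴d² follows m ≥
    -- 50κ⁴d², all that the moment estimate asks.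
    have hgood : ∀ m, ⌊100 * shape f ^ 4 * (d : ℝ) ^ 2⌋₊ ≤ m →
        Measure.pi (fun _ : Fin m => law f) {x | ¬ GoodSample (sepFactor K w₀) f x} ≤
          ENNReal.ofReal (failureProb m) := by
      intro m hm
      refine le_failureProb _ _ m fun hm700 => ?_
      have hm' : (700 : ℝ) ≤ m := by exact_mod_cast hm700
      have hfl := Nat.lt_floor_add_one (100 * shape f ^ 4 * (d : ℝ) ^ 2)
      have hm2 : (⌊100 * shape f ^ 4 * (d : ℝ) ^ 2⌋₊ : ℝ) ≤ m := by exact_mod_cast hm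
      have h1 := (hasLawOn_univ (f := f)).real_not_goodMoments_le (n := m)
        (isWhite_map_whiten hf hs hd) (by omega) hd (by linarith)
        (C := fun _ => Finset.univ) (fun ω i => by simp)
      rw [mul_one] at h1
      have h2 : (m : ℝ) ^ (1 / 5 : ℝ) ≤ Real.sqrt m := by
        rw [Real.sqrt_eq_rpow]
        exact Real.rpow_le_rpow_of_exponent_le (by linarith) (by norm_num)
      have h3 : 0 < (m : ℝ) ^ (1 / 5 : ℝ) := Real.rpow_pos_of_pos (by linarith) _
      have hsub : {x : Fin m → E d | ¬ GoodSample (sepFactor K w₀) f x} ⊆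
          {x | ¬ (9 / 10 * (m : ℝ) ≤ (Finset.univ : Finset (Fin m)).card ∧
            GoodMoments (fun i => whiten f (x i)) Finset.univ)} := fun ω hω hg =>
        hω (goodSample_of_goodMoments hf hs hγ hg.2)
      refine (measureReal_mono hsub (measure_ne_top _ _)).trans (h1.trans ?_)
      gcongr
      norm_num
    have hle : sampleComplexity failureProb (sepFactor K w₀) f ≤
        (⌊100 * shape f ^ 4 * (d : ℝ) ^ 2⌋₊ : ℕ∞) := iInf₂_le _ hgood
    obtain ⟨s, hs'⟩ := ENat.ne_top_iff_exists.1 (ne_top_of_le_ne_top (ENat.natCast_ne_top _) hle)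
    refine ⟨s, hs'.symm, ?_⟩
    rw [← hs'] at hle
    exact (Nat.cast_le.2 (ENat.natCast_le_natCast.1 hle)).trans (Nat.floor_le hX)
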